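/- **Setting.** The field operators $\varphi_1,\dots,\varphi_N$ of $N$ local Fermionic modes satisfy the canonical anticommutation relations and act on the $2^N$-dimensional Fock space with vacuum $|\Omega\rangle$. The modes are distributed among $n$ parties $1,\dots,n$. For an ordering $\pi$ of the modes, the Jordan–Wigner transform is $J_\pi(X)=U^\pi X (U^\pi)^\dagger$, where the unitary $U^\pi$ maps $(\varphi_{\pi(1)}^\dagger)^{s_{\pi(1)}}\cdots(\varphi_{\pi(N)}^\dagger)^{s_{\pi(N)}}|\Omega\rangle$ to the computational basis vector $|s_1,\dots,s_N\rangle$ of $N$ qubits. The party that holds a mode also holds the qubit with the same label. An LOCC protocol is a finite sequence of rounds. In each round one party performs a test (finitely many transformations, each with finitely many Kraus operators, whose sum is trace preserving) chosen according to its own classical record, adds the outcome to its record, and sends to the other parties bit strings of prescribed lengths, computed from its record. The protocol is Fermionic if every Kraus operator of a party is a linear combination of products of an even number, or of products of an odd number, of field operators $\varphi_k,\varphi_k^\dagger$ of the modes of that party. It is a qubit protocol if every Kraus operator of a party has the form $A\otimes I$ with $A$ acting on the qubits of that party. A qubit protocol $Q$ corresponds to a Fermionic protocol $P$ under $J_\pi$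 if each party can read its record of $P$ off its own record of $Q$ in such a way that, for every set of final joint records of $P$, the transformation that $P$ performs when the final records lie in this set is carried by $J_\pi$ to the transformation that $Q$ performs when the records read off lie in this set. **Proposition.** There is an ordering $\pi$ in which the modes of party $i$ precede those of party $j$ whenever $i<j$, and for every such $\pi$ the following hold. 1. To every $n$-partite Fermionic LOCC protocol $P$ there corresponds under $J_\pi$ an $n$-partite qubit LOCC protocol $Q$ for the same parties, with an overall overhead of $n-1$ classical bits: for $i=2,\dots,n$ party $i$ sends to party $i-1$ exactly one bit more in $Q$ than in $P$, and between all other ordered pairs of parties the number of bits is the same. 2. Let $n=2$, and call party $1$ (whose modes come first) Bob and party $2$ Alice. Every Fermionic LOCC protocol $P$ corresponds under $J_\pi$ to a qubit LOCC protocol round by round (that is, every initial segment of $P$ corresponds to the respective initial segment of the qubit protocol), with an overhead of one classical bit for each round of Alice and of no bit for a round of Bob. A round of Bob is replaced by a round of Bob with the same outcomes and messages, whose transformations are the images under $J_\pi$ of his Fermionic ones. In a round of Alice each transformation $\mathcal T$ is refined to $\mathcal T_e+\mathcal T_o$, where $\mathcal T_e$ has only even and $\mathcal T_o$ only odd Kraus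 operators; the additional bit tells Bob which of the two occurred, that is, the parity of the Kraus operator. Bob then applies the string of $\sigma_z$'s on all his qubits if the parity is odd, and nothing if it is even; the image under $J_\pi$ of $\mathcal T_e$ is Alice's qubit transformation for the even outcome, and that of $\mathcal T_o$ is Alice's qubit transformation for the odd outcome followed by this string on Bob's side. -/

import Mathlib

namespace FermionicLOCC

open scoped Matrix

noncomputable section

/-! ### Operators on `N` modes and on `N` qubits -/

/-- Occupation numbers of `N` modes; also the labels of the computational basis of `N` qubits. -/
abbrev Conf (N : ℕ) := Fin N → Bool

/-- Linear operators on a `2 ^ N`-dimensional Hilbert space with orthonormal basis `Conf N`. -/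
abbrev Op (N : ℕ) := Matrix (Conf N) (Conf N) ℂ

/-- Linear maps on operators. -/
abbrev SuperOp (N : ℕ) := Op N →ₗ[ℂ] Op N

/-- The annihilation operator of the mode `i` on the Fock space of `N` modes, in the basis
`|s₁, …, s_N⟩ = (φ₁†)^{s₁} ⋯ (φ_N†)^{s_N} |Ω⟩`: it kills `|t⟩` if `t i = 0`, and otherwise it
empties the mode `i` with the sign `(-1) ^ (∑ j < i, t j)`. -/
def fermi {N : ℕ} (i : Fin N) : Op N := fun s t =>
  if t i = true ∧ s = Function.update t i false then
    (-1) ^ (Finset.univ.filter fun j : Fin N => j < i ∧ t j = true).card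
  else 0

/-- The vacuum vector `|Ω⟩`. -/
def vacuum (N : ℕ) : Conf N → ℂ := Pi.single (fun _ => false) 1

/-- The Fock vector of the ordering `π` of the modes:
`|s⟩^π = (φ_{π(1)}†)^{s_{π(1)}} ⋯ (φ_{π(N)}†)^{s_{π(N)}} |Ω⟩`. -/
def fockVector {N : ℕ} (π : Equiv.Perm (Fin N)) (s : Conf N) : Conf N → ℂ :=
  (List.ofFn fun k : Fin N => if s (π k) = true then (fermi (π k))ᴴ else 1).prod *ᵥ vacuum N

/-- The matrix with columns `|s⟩^π`, i.e. the inverse of the unitary map `U^π` that sends the Fock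
vector `|s⟩^π` to the vector `|s⟩` of the computational basis of the qubits. -/
def fockMatrix {N : ℕ} (π : Equiv.Perm (Fin N)) : Op N := fun t s => fockVector π s t

/-- The Jordan-Wigner transform of the ordering `π`: `J_π(X) = U^π X (U^π)†`. -/
def jordanWigner {N : ℕ} (π : Equiv.Perm (Fin N)) (X : Op N) : Op N :=
  (fockMatrix π)ᴴ * X * fockMatrix π

/-! ### Local operators -/

/-- The field operators `φ_i`, `φ_i†` of the modes in `S`. -/
def fieldOps {N : ℕ} (S : Set (Fin N)) : Set (Op N) :=
  {X | ∃ i ∈ S, X = fermi i ∨ X = (fermi i)ᴴ}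

/-- Linear combinations of products of an even number of field operators of modes in `S`. -/
def evenOps {N : ℕ} (S : Set (Fin N)) : Submodule ℂ (Op N) :=
  Submodule.span ℂ
    {X | ∃ l : List (Op N), (∀ x ∈ l, x ∈ fieldOps S) ∧ Even l.length ∧ X = l.prod}

/-- Linear combinations of products of an odd number of field operators of modes in `S`. -/
def oddOps {N : ℕ} (S : Set (Fin N)) : Submodule ℂ (Op N) :=
  Submodule.span ℂ
    {X | ∃ l : List (Op N), (∀ x ∈ l, x ∈ fieldOps S) ∧ Odd l.length ∧ X = l.prod}

/-- The modes (or qubits) controlled by the party `i`. -/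
def modesOf {n N : ℕ} (owner : Fin N → Fin n) (i : Fin n) : Set (Fin N) := {k | owner k = i}

/-- The admissible Kraus operators of the party `i` in the Fermionic theory: even or odd
combinations of products of field operators of its modes. -/
def fermionicKraus {n N : ℕ} (owner : Fin N → Fin n) (i : Fin n) : Set (Op N) :=
  {K | K ∈ evenOps (modesOf owner i) ∨ K ∈ oddOps (modesOf owner i)}

open Classical in
/-- The admissible Kraus operators of the party `i` in qubit quantum theory: the operators
`A ⊗ I`, with an arbitrary `A` on the qubits of the party `i` and `I` on all other qubits. -/
def qubitKraus {n N : ℕ} (owner : Fin N → Fin n) (i : Fin n) : Set (Op N) :=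
  {K | ∃ A : Matrix (modesOf owner i → Bool) (modesOf owner i → Bool) ℂ,
    K = fun s t =>
      if ∀ j, j ∉ modesOf owner i → s j = t j then A (fun j => s j) (fun j => t j) else 0}

/-- The string of the Pauli matrices `σ_z` on all qubits of the party `i`. -/
def zString {n N : ℕ} (owner : Fin N → Fin n) (i : Fin n) : Op N :=
  Matrix.diagonal fun s =>
    ∏ j ∈ Finset.univ.filter (fun j => owner j = i), if s j = true then (-1 : ℂ) else 1

/-! ### Transformations and tests -/

/-- The map `ρ ↦ K ρ K†`. -/
def conjBy {N : ℕ} (K : Op N) : SuperOp N := LinearMap.mulLeftRight ℂ (K, Kᴴ)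

/-- `T` is a transformation with finitely many Kraus operators, all of them in `L`. -/
def IsTransformation {N : ℕ} (L : Set (Op N)) (T : SuperOp N) : Prop :=
  ∃ (m : ℕ) (K : Fin m → Op N), (∀ a, K a ∈ L) ∧ T = ∑ a, conjBy (K a)

/-- `T 0, …, T (k - 1)` is a test: transformations with Kraus operators in `L` whose sum preserves
the trace. -/
def IsTest {N : ℕ} (L : Set (Op N)) (k : ℕ) (T : ℕ → SuperOp N) : Prop :=
  (∀ a < k, IsTransformation L (T a)) ∧
    ∀ ρ : Op N, (∑ a ∈ Finset.range k, T a ρ).trace = ρ.trace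

/-! ### Protocols -/

/-- An entry in the classical record of a party: an outcome of one of its own tests, or a bit string
received from the party `sender`. -/
inductive Entry (n : ℕ) where
  | outcome (a : ℕ) : Entry n
  | message (sender : Fin n) (bits : List Bool) : Entry n

/-- The classical record of a party, in chronological order. -/
abbrev View (n : ℕ) := List (Entry n)

/-- A round: `party` performs a test with the outcomes `0, …, outcomes - 1`, chosen according to its
own record, adds the outcome to its record, and sends to every other party `j` a string of `bits j`
bits, which is computed from its (extended) record. -/
structure Round (n N : ℕ) where
  party : Fin n
  outcomes : ℕ
  test : View n → ℕ → SuperOp N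
  bits : Fin n → ℕ
  msg : Fin n → View n → ℕ → Bool

/-- The bit string sent to `j` by the acting party, if the record of the latter is `v`. -/
def Round.message {n N : ℕ} (r : Round n N) (j : Fin n) (v : View n) : List Bool :=
  (List.range (r.bits j)).map (r.msg j v)

/-- The records of all parties after a round with the outcome `a`. -/
def Round.next {n N : ℕ} (r : Round n N) (v : Fin n → View n) (a : ℕ) : Fin n → View n :=
  fun j =>
    if j = r.party then v j ++ [Entry.outcome a]
    else v j ++ [Entry.message r.party (r.message j (v r.party ++ [Entry.outcome a]))]

/-- A protocol is a finite sequence of rounds. -/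
abbrev Protocol (n N : ℕ) := List (Round n N)

/-- The protocol consists of tests with local Kraus operators: those of the party `i` are in
`L i`. -/
def IsLOCC {n N : ℕ} (L : Fin n → Set (Op N)) (P : Protocol n N) : Prop :=
  ∀ r ∈ P, ∀ v : View n, IsTest (L r.party) r.outcomes (r.test v)

/-- Fermionic protocols of local operations and classical communication. -/
def IsFermionicLOCC {n N : ℕ} (owner : Fin N → Fin n) (P : Protocol n N) : Prop :=
  IsLOCC (fermionicKraus owner) P

/-- Qubit protocols of local operations and classical communication. -/
def IsQubitLOCC {n N : ℕ} (owner : Fin N → Fin n) (P : Protocol n N) : Prop :=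
  IsLOCC (qubitKraus owner) P

open Classical in
/-- The transformation that the protocol performs, started with the records `v`, when the final
records of the parties are in `S` (the sum over all branches of the protocol that end in `S`). -/
def event {n N : ℕ} : Protocol n N → (Fin n → View n) → Set (Fin n → View n) → SuperOp N
  | [], v, S => if v ∈ S then LinearMap.id else 0
  | r :: P, v, S =>
      ∑ a ∈ Finset.range r.outcomes, event P (r.next v a) S ∘ₗ r.test (v r.party) a

/-- The Jordan-Wigner transform `J_π` carries the protocol `P` to the protocol `Q`. In `Q` the
party `i` reads its record of `P` off its own record by means of `f i`, and for every
event `S` about the final records of `P`, the transformations of `P` and of `Q` that belong to `S`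
correspond to each other under `J_π`. -/
def Corresponds {n N : ℕ} (π : Equiv.Perm (Fin N)) (f : Fin n → View n → View n)
    (P Q : Protocol n N) : Prop :=
  ∀ (S : Set (Fin n → View n)) (ρ : Op N),
    jordanWigner π (event P (fun _ => []) S ρ) =
      event Q (fun _ => []) {u | (fun i => f i (u i)) ∈ S} (jordanWigner π ρ)

/-! ### Amount of communication -/

/-- The number of bits sent from `i` to `j` during the protocol. -/
def linkBits {n N : ℕ} (P : Protocol n N) (i j : Fin n) : ℕ :=
  (P.map fun r => if r.party = i ∧ j ≠ i then r.bits j else 0).sum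

/-- The number of bits sent during the protocol. -/
def totalBits {n N : ℕ} (P : Protocol n N) : ℕ := ∑ i, ∑ j, linkBits P i j

/-! ### Simulation of a single round of two parties

The party `0` controls the modes that come first in the ordering, the party `1` those that come
last. -/

/-- A round `r` of the party `0` is replaced by a round `q` of the same party with the same
outcomes and the same messages. -/
structure IsFirstPartyRound {N : ℕ} (π : Equiv.Perm (Fin N)) (f : Fin 2 → View 2 → View 2)
    (r q : Round 2 N) : Prop where
  party_eq : q.party = 0
  outcomes_eq : q.outcomes = r.outcomes
  test_eq : ∀ (u : View 2), ∀ a < r.outcomes, ∀ ρ : Op N,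
    jordanWigner π (r.test (f 0 u) a ρ) = q.test u a (jordanWigner π ρ)
  bits_eq : q.bits 1 = r.bits 1
  message_eq : ∀ (u : View 2), ∀ a < r.outcomes,
    q.message 1 (u ++ [Entry.outcome a]) = r.message 1 (f 0 u ++ [Entry.outcome a])

/-- A round `r` of the party `1` is replaced by a round `q` of the party `1` and a round `c` of the
party `0`. In `q` every transformation of `r` is refined to its part with even Kraus operators
(outcome `2 * a`) and its part with odd Kraus operators (outcome `2 * a + 1`), and one more bit
is sent, which says which of the two occurred. In `c` the party `0` applies the string of `σ_z` on
its own qubits if the bit says odd, does nothing if it says even, and sends nothing. -/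
structure IsSecondPartyRound {N : ℕ} (owner : Fin N → Fin 2) (π : Equiv.Perm (Fin N))
    (f : Fin 2 → View 2 → View 2) (r q c : Round 2 N) : Prop where
  party_eq : q.party = 1
  outcomes_eq : q.outcomes = 2 * r.outcomes
  test_eq : ∀ (u : View 2), ∀ a < r.outcomes, ∃ E O : SuperOp N,
    IsTransformation (evenOps (modesOf owner 1) : Set (Op N)) E ∧
    IsTransformation (oddOps (modesOf owner 1) : Set (Op N)) O ∧
    r.test (f 1 u) a = E + O ∧
    (∀ ρ : Op N, jordanWigner π (E ρ) = q.test u (2 * a) (jordanWigner π ρ)) ∧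
    (∀ ρ : Op N, jordanWigner π (O ρ) =
      conjBy (zString owner 0) (q.test u (2 * a + 1) (jordanWigner π ρ)))
  bits_eq : q.bits 0 = r.bits 0 + 1
  message_even : ∀ (u : View 2), ∀ a < r.outcomes,
    q.message 0 (u ++ [Entry.outcome (2 * a)]) =
      r.message 0 (f 1 u ++ [Entry.outcome a]) ++ [false]
  message_odd : ∀ (u : View 2), ∀ a < r.outcomes,
    q.message 0 (u ++ [Entry.outcome (2 * a + 1)]) =
      r.message 0 (f 1 u ++ [Entry.outcome a]) ++ [true]
  correction_party : c.party = 0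
  correction_outcomes : c.outcomes = 1
  correction_even : ∀ (u : View 2) (m : List Bool),
    c.test (u ++ [Entry.message 1 (m ++ [false])]) 0 = LinearMap.id
  correction_odd : ∀ (u : View 2) (m : List Bool),
    c.test (u ++ [Entry.message 1 (m ++ [true])]) 0 = conjBy (zString owner 0)
  correction_bits : c.bits 1 = 0

/-- The round `r` is replaced by the block `b` of rounds. -/
def IsRoundBlock {N : ℕ} (owner : Fin N → Fin 2) (π : Equiv.Perm (Fin N))
    (f : Fin 2 → View 2 → View 2) (r : Round 2 N) (b : Protocol 2 N) : Prop :=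
  (r.party = 0 ∧ ∃ q, b = [q] ∧ IsFirstPartyRound π f r q) ∨
    (r.party = 1 ∧ ∃ q c, b = [q, c] ∧ IsSecondPartyRound owner π f r q c)

end

end FermionicLOCC

open FermionicLOCC

namespace FermionicLOCC

open scoped Matrix Kronecker

noncomputable section

/-! Each mode occurs exactly once in an ordering, so the Fock vectors of `π` are the standard basis
vectors up to signs. Hence `fockMatrix π` is diagonal with entries `±1` (`fockMatrix_eq_diagonal`),
and `J_π` is an involution that fixes every diagonal operator, in particular every string of `σ_z`.
Conjugation by these signs replaces the sign string of `φ_k` over the modes `j < k` by the one over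
the modes preceding `k` in `π` (`jordanWigner_fermi_apply`).

If `owner ∘ π` is monotone, that string consists of `σ_z` on all qubits of the earlier parties and
on some qubits of the owner of `k`. In an even product the foreign parts cancel, so even Kraus
operators become local; odd ones become local after multiplication by the string `before i` on all
earlier parties (`jordanWigner_mem_of_mem_evenOps`, `zPow_before_mul_mem_of_mem_oddOps`). A party
can therefore refine its test by parity, perform the local factor, and leave the missing string to
the earlier parties.

These corrections can wait: a string of `σ_z` commutes with a Kraus operator of definite parity up
to a sign, and the sign cancels in `K ρ K†` (`conjBy_zPow_comm`). At the end party `i` has to apply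
its string once for each odd outcome of a later party (`needed`), and only the parity of that number
counts. These parities are passed down from the last party to the first, one bit per step, which
makes `n - 1` bits (`run_refinedRounds`, `event_closingRounds`).

For two parties the parity is instead sent with each message of party `1`, and party `0` corrects at
once. No string is then pending after a block of rounds, so the correspondence holds for every
initial segment (`event_flatten_map_roundBlock`). -/

/-- The factor `-1` of an occupied mode. -/
def occSign {N : ℕ} (s : Conf N) (j : Fin N) : ℂ := if s j = true then -1 else 1

theorem occSign_mul_self {N : ℕ} (s : Conf N) (j : Fin N) : occSign s j * occSign s j = 1 := by
  unfold occSign; split_ifs <;> norm_num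

theorem fermi_apply {N : ℕ} (i : Fin N) (s t : Conf N) :
    fermi i s t = if t i = true ∧ s = Function.update t i false then
      ∏ j, (if j < i then occSign t j else 1) else 0 := by
  unfold fermi
  congr 1
  rw [← Finset.prod_const, Finset.prod_filter]
  refine Finset.prod_congr rfl fun j _ => ?_
  by_cases h1 : j < i <;> by_cases h2 : t j = true <;> simp [occSign, h1, h2]

/-! ### The sign of a Fock vector -/

/-- The sign of the Fock vector that is built from the vacuum by the creation operators of the
occupied modes in the list, the first one acting last. -/
def listSign {N : ℕ} (s : Conf N) : List (Fin N) → ℂ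
  | [] => 1
  | i :: l => (if s i = true then (l.map fun j => if j < i then occSign s j else 1).prod else 1) *
      listSign s l

theorem list_prod_mul_self {ι : Type*} (f : ι → ℂ) (h : ∀ i, f i * f i = 1) (l : List ι) :
    (l.map f).prod * (l.map f).prod = 1 := by
  induction l with
  | nil => simp
  | cons i l ih =>
    simp only [List.map_cons, List.prod_cons]
    rw [mul_mul_mul_comm, h, ih, one_mul]

theorem list_prod_star {ι : Type*} (f : ι → ℂ) (h : ∀ i, star (f i) = f i) (l : List ι) :
    star ((l.map f).prod) = (l.map f).prod := by
  induction l with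
  | nil => simp
  | cons i l ih =>
    simp only [List.map_cons, List.prod_cons, star_mul']
    rw [h, ih]

theorem star_occSign {N : ℕ} (s : Conf N) (j : Fin N) : star (occSign s j) = occSign s j := by
  unfold occSign; split_ifs <;> simp

theorem listSign_mul_self {N : ℕ} (s : Conf N) (l : List (Fin N)) :
    listSign s l * listSign s l = 1 := by
  induction l with
  | nil => simp [listSign]
  | cons i l ih =>
    simp only [listSign]
    rw [mul_mul_mul_comm, ih, mul_one]
    split_ifs
    · exact list_prod_mul_self _ (fun j => by split_ifs <;> simp [occSign_mul_self]) l
    · simp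

theorem star_listSign {N : ℕ} (s : Conf N) (l : List (Fin N)) :
    star (listSign s l) = listSign s l := by
  induction l with
  | nil => simp [listSign]
  | cons i l ih =>
    simp only [listSign, star_mul', ih]
    congr 1
    split_ifs
    · exact list_prod_star _ (fun j => by split_ifs <;> simp [star_occSign]) l
    · simp

theorem conjTranspose_fermi_mulVec_single {N : ℕ} (i : Fin N) (t : Conf N) (h : t i = false) :
    (fermi i)ᴴ *ᵥ Pi.single t 1 =
      (∏ j, if j < i then occSign t j else 1) • Pi.single (Function.update t i true) (1 : ℂ) := by
  ext s
  rw [Matrix.mulVec_single_one]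
  simp only [Matrix.col_apply, Matrix.conjTranspose_apply, fermi_apply, Pi.smul_apply,
    smul_eq_mul, Pi.single_apply]
  by_cases hs : s = Function.update t i true
  · subst hs
    simp only [Function.update_self, Function.update_idem, true_and, if_true, mul_one]
    rw [if_pos (by rw [← h, Function.update_eq_self]), star_prod]
    refine Finset.prod_congr rfl fun j _ => ?_
    split_ifs with hj
    · rw [star_occSign]; simp [occSign, Function.update_of_ne hj.ne]
    · simp
  · rw [if_neg, if_neg hs]
    · simp
    · rintro ⟨h1, h2⟩
      exact hs (by rw [h2, Function.update_idem, ← h1, Function.update_eq_self])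

/-- Creation operators are applied from the end of the list. The list has no repetitions, so each
one meets an empty mode and contributes only its sign. Masking the configuration by membership in
the list describes the vector at intermediate stages. -/
theorem fock_list_mulVec {N : ℕ} (s : Conf N) (l : List (Fin N)) (hl : l.Nodup) :
    (l.map fun k => if s k = true then (fermi k)ᴴ else 1).prod *ᵥ vacuum N =
      listSign s l • Pi.single (fun j => s j && decide (j ∈ l)) (1 : ℂ) := by
  induction l with
  | nil =>
    ext t
    simp [listSign, vacuum, Matrix.one_apply, Pi.single_apply]
  | cons i l ih =>
    obtain ⟨hi, hl⟩ := List.nodup_cons.1 hl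
    simp only [List.map_cons, List.prod_cons]
    rw [← Matrix.mulVec_mulVec, ih hl]
    simp only [listSign]
    by_cases hs : s i = true
    · rw [if_pos hs, if_pos hs, Matrix.mulVec_smul,
        conjTranspose_fermi_mulVec_single _ _ (by simp [hi]), smul_smul, mul_comm]
      congr 2
      · rw [← Finset.prod_subset (Finset.subset_univ l.toFinset),
          List.prod_toFinset _ hl]
        · congr 1
          refine List.map_congr_left fun j hj => ?_
          simp [occSign, hj]
        · intro j _ hj
          simp only [List.mem_toFinset] at hj
          simp [occSign, hj]
      · ext j
        by_cases hj : j = i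
        · subst hj; simp [hs]
        · simp [hj]
    · rw [if_neg hs, if_neg hs, Matrix.one_mulVec, one_mul]
      congr 2
      ext j
      by_cases hj : j = i
      · subst hj; simp [hs]
      · simp [hj]

/-- The sign of the Fock vector of the ordering `π`. -/
def fockSign {N : ℕ} (π : Equiv.Perm (Fin N)) (s : Conf N) : ℂ := listSign s (List.ofFn π)

theorem fockMatrix_eq_diagonal {N : ℕ} (π : Equiv.Perm (Fin N)) :
    fockMatrix π = Matrix.diagonal (fockSign π) := by
  ext t s
  have h := fock_list_mulVec s (List.ofFn π) (List.nodup_ofFn.2 π.injective)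
  have h2 : (fun j => s j && decide (j ∈ List.ofFn π)) = s := by
    ext j
    simp [List.mem_ofFn, π.surjective j]
  rw [h2, List.map_ofFn] at h
  have h3 : fockMatrix π t s = fockVector π s t := rfl
  rw [h3]
  unfold fockVector
  have h4 := congrFun h t
  refine Eq.trans h4 ?_
  by_cases hts : t = s
  · subst hts; simp [fockSign]
  · simp [hts]

/-- Emptying a mode `k` of a list that is sorted by `g` changes its sign by the standard sign of
`k` and the sign of the occupied modes before `k`. -/
theorem listSign_update {N : ℕ} (g : Fin N → Fin N) (s : Conf N) (k : Fin N) (hs : s k = true)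
    (l : List (Fin N)) (hl : l.Pairwise fun a b => g a < g b) (hk : k ∈ l) :
    listSign s l * (l.map fun j => if j < k then occSign s j else 1).prod =
      (l.map fun j => if g j < g k then occSign s j else 1).prod *
        listSign (Function.update s k false) l := by
  have occ_update : ∀ j, j ≠ k → occSign (Function.update s k false) j = occSign s j := by
    intro j hj; simp [occSign, hj]
  have sign_update : ∀ l : List (Fin N), k ∉ l →
      listSign (Function.update s k false) l = listSign s l := by
    intro l
    induction l with
    | nil => simp [listSign]
    | cons i l ih =>
      intro h
      simp only [List.mem_cons, not_or] at h
      simp only [listSign, ih h.2, Function.update_of_ne (Ne.symm h.1)]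
      congr 3
      refine List.map_congr_left fun j hj => ?_
      rw [occ_update]
      rintro rfl; exact h.2 hj
  induction l with
  | nil => simp at hk
  | cons i l ih =>
    obtain ⟨hi, hl⟩ := List.pairwise_cons.1 hl
    simp only [listSign, List.map_cons, List.prod_cons]
    by_cases hik : i = k
    · subst hik
      have hil : i ∉ l := fun h => lt_irrefl _ (hi i h)
      have e : (l.map fun j => if g j < g i then occSign s j else 1).prod = 1 := by
        apply List.prod_eq_one
        intro x hx
        obtain ⟨j, hj, rfl⟩ := List.mem_map.1 hx
        rw [if_neg (hi j hj).not_gt]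
      rw [sign_update l hil, e]
      simp only [hs, if_true, lt_irrefl, if_false, one_mul, Function.update_self]
      -- The creation operator of `i` acts last and contributes exactly the standard sign over the
      -- tail, which squares to `1`.
      rw [mul_right_comm, list_prod_mul_self _ (fun j => by split_ifs <;> simp [occSign_mul_self])]
      simp
    · have hkl : k ∈ l := by
        rcases List.mem_cons.1 hk with h | h
        · exact absurd h.symm hik
        · exact h
      have ih := ih hl hkl
      rw [if_pos (hi k hkl)]
      rw [Function.update_of_ne hik]
      by_cases hsi : s i = true
      · rw [if_pos hsi, if_pos hsi]
        -- The factor of an occupied head `i` sees the mode `k` only if `k < i`; emptying `k` then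
        -- costs a sign.
        have e : (l.map fun j => if j < i then occSign (Function.update s k false) j else 1).prod =
            (if k < i then -1 else 1) *
              (l.map fun j => if j < i then occSign s j else 1).prod := by
          have hnd : l.Nodup := hl.imp fun h => by rintro rfl; exact lt_irrefl _ h
          rw [← List.prod_toFinset _ hnd, ← List.prod_toFinset _ hnd,
            ← Finset.mul_prod_erase _ _ (List.mem_toFinset.2 hkl),
            ← Finset.mul_prod_erase l.toFinset (fun j => if j < i then occSign s j else 1)
              (List.mem_toFinset.2 hkl), ← mul_assoc]
          congr 1
          · simp only [occSign, Function.update_self, hs]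
            split_ifs <;> simp_all
          · refine Finset.prod_congr rfl fun j hj => ?_
            rw [occ_update _ (Finset.ne_of_mem_erase hj)]
        rw [e]
        -- The sign from `e` makes up for the difference between the standard order and that of `g`,
        -- in which `i` always precedes `k`.
        have e2 : (if i < k then occSign s i else 1) = occSign s i * (if k < i then -1 else 1) := by
          rcases lt_trichotomy i k with h | h | h
          · simp [h, h.not_gt]
          · exact absurd h hik
          · simp [h, h.not_gt, occSign, hsi]
        rw [e2]
        linear_combination (l.map fun j => if j < i then occSign s j else 1).prod *
          occSign s i * (if k < i then -1 else 1) * ih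
      · rw [if_neg hsi, if_neg hsi]
        have e2 : occSign s i = 1 := by simp [occSign, hsi]
        rw [e2]
        simp only [ite_self, one_mul]
        exact ih

theorem fockSign_mul_self {N : ℕ} (π : Equiv.Perm (Fin N)) (s : Conf N) :
    fockSign π s * fockSign π s = 1 := listSign_mul_self _ _

/-! ### The Jordan-Wigner transform -/

theorem conjTranspose_fockMatrix {N : ℕ} (π : Equiv.Perm (Fin N)) :
    (fockMatrix π)ᴴ = fockMatrix π := by
  rw [fockMatrix_eq_diagonal, Matrix.diagonal_conjTranspose]
  congr 1
  ext s
  exact star_listSign _ _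

theorem fockMatrix_mul_self {N : ℕ} (π : Equiv.Perm (Fin N)) :
    fockMatrix π * fockMatrix π = 1 := by
  rw [fockMatrix_eq_diagonal, Matrix.diagonal_mul_diagonal, ← Matrix.diagonal_one]
  congr 1
  ext s
  exact fockSign_mul_self _ _

theorem jordanWigner_apply {N : ℕ} (π : Equiv.Perm (Fin N)) (X : Op N) (s t : Conf N) :
    jordanWigner π X s t = fockSign π s * X s t * fockSign π t := by
  rw [jordanWigner, conjTranspose_fockMatrix, fockMatrix_eq_diagonal, Matrix.mul_diagonal,
    Matrix.diagonal_mul]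

/-- The Fock signs before and after the removal of `k` differ by the ratio of the standard string to
the string of `π` (`listSign_update` with `g = π.symm`), so the standard string drops out. -/
theorem jordanWigner_fermi_apply {N : ℕ} (π : Equiv.Perm (Fin N)) (k : Fin N) (s t : Conf N) :
    jordanWigner π (fermi k) s t = if t k = true ∧ s = Function.update t k false then
      ∏ j, (if π.symm j < π.symm k then occSign t j else 1) else 0 := by
  rw [jordanWigner_apply, fermi_apply]
  split_ifs with h
  · obtain ⟨h1, rfl⟩ := h
    have key := listSign_update π.symm t k h1 (List.ofFn π)
      (by
        rw [List.pairwise_ofFn]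
        intro i j hij
        simpa using hij)
      (by simp [List.mem_ofFn, π.surjective k])
    rw [List.map_ofFn, List.map_ofFn, List.prod_ofFn, List.prod_ofFn] at key
    simp only [Function.comp_apply] at key
    rw [Equiv.prod_comp π (fun j => if j < k then occSign t j else 1),
      Equiv.prod_comp π (fun j => if π.symm j < π.symm k then occSign t j else 1)] at key
    have e := listSign_mul_self (Function.update t k false) (List.ofFn π)
    unfold fockSign
    linear_combination listSign (Function.update t k false) (List.ofFn π) * key +
      (∏ j, (if π.symm j < π.symm k then occSign t j else 1)) * e
  · simp

theorem jordanWigner_mul {N : ℕ} (π : Equiv.Perm (Fin N)) (X Y : Op N) :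
    jordanWigner π (X * Y) = jordanWigner π X * jordanWigner π Y := by
  simp only [jordanWigner, conjTranspose_fockMatrix]
  calc _ = fockMatrix π * X * 1 * Y * fockMatrix π := by simp only [mul_one, mul_assoc]
    _ = _ := by rw [← fockMatrix_mul_self π]; simp only [mul_assoc]

theorem jordanWigner_one {N : ℕ} (π : Equiv.Perm (Fin N)) : jordanWigner π (1 : Op N) = 1 := by
  simp [jordanWigner, conjTranspose_fockMatrix, fockMatrix_mul_self]

theorem jordanWigner_conjTranspose {N : ℕ} (π : Equiv.Perm (Fin N)) (X : Op N) :
    jordanWigner π Xᴴ = (jordanWigner π X)ᴴ := by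
  simp only [jordanWigner, conjTranspose_fockMatrix, Matrix.conjTranspose_mul, mul_assoc]

theorem jordanWigner_jordanWigner {N : ℕ} (π : Equiv.Perm (Fin N)) (X : Op N) :
    jordanWigner π (jordanWigner π X) = X := by
  simp only [jordanWigner, conjTranspose_fockMatrix]
  calc _ = (fockMatrix π * fockMatrix π) * X * (fockMatrix π * fockMatrix π) := by
        simp only [mul_assoc]
    _ = X := by simp [fockMatrix_mul_self]

theorem jordanWigner_diagonal {N : ℕ} (π : Equiv.Perm (Fin N)) (d : Conf N → ℂ) :
    jordanWigner π (Matrix.diagonal d) = Matrix.diagonal d := by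
  ext s t
  rw [jordanWigner_apply]
  by_cases h : s = t
  · subst h
    simp only [Matrix.diagonal_apply_eq]
    linear_combination d s * fockSign_mul_self π s
  · simp [h]

theorem trace_jordanWigner {N : ℕ} (π : Equiv.Perm (Fin N)) (X : Op N) :
    (jordanWigner π X).trace = X.trace := by
  rw [jordanWigner, conjTranspose_fockMatrix, Matrix.trace_mul_comm, ← mul_assoc,
    fockMatrix_mul_self, one_mul]

/-- The Jordan-Wigner transform as a linear map. -/
def jwMap {N : ℕ} (π : Equiv.Perm (Fin N)) : SuperOp N :=
  LinearMap.mulLeftRight ℂ ((fockMatrix π)ᴴ, fockMatrix π)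

@[simp] theorem jwMap_apply {N : ℕ} (π : Equiv.Perm (Fin N)) (X : Op N) :
    jwMap π X = jordanWigner π X := by
  simp [jwMap, jordanWigner, LinearMap.mulLeftRight_apply]

/-- The image of a linear map on operators under the Jordan-Wigner transform. -/
def jwSuper {N : ℕ} (π : Equiv.Perm (Fin N)) (T : SuperOp N) : SuperOp N :=
  jwMap π ∘ₗ T ∘ₗ jwMap π

theorem jwSuper_jordanWigner {N : ℕ} (π : Equiv.Perm (Fin N)) (T : SuperOp N) (ρ : Op N) :
    jwSuper π T (jordanWigner π ρ) = jordanWigner π (T ρ) := by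
  simp [jwSuper, jordanWigner_jordanWigner]

theorem jwSuper_comp {N : ℕ} (π : Equiv.Perm (Fin N)) (T T' : SuperOp N) :
    jwSuper π (T ∘ₗ T') = jwSuper π T ∘ₗ jwSuper π T' := by
  ext1 ρ
  simp [jwSuper, jordanWigner_jordanWigner]

theorem jwSuper_add {N : ℕ} (π : Equiv.Perm (Fin N)) (T T' : SuperOp N) :
    jwSuper π (T + T') = jwSuper π T + jwSuper π T' := by
  simp [jwSuper, LinearMap.comp_add, LinearMap.add_comp]

theorem jwSuper_zero {N : ℕ} (π : Equiv.Perm (Fin N)) : jwSuper π (0 : SuperOp N) = 0 := by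
  simp [jwSuper]

theorem jwSuper_id {N : ℕ} (π : Equiv.Perm (Fin N)) :
    jwSuper π (LinearMap.id : SuperOp N) = LinearMap.id := by
  ext1 ρ
  simp [jwSuper, jordanWigner_jordanWigner]

theorem jwSuper_sum {N : ℕ} {ι : Type*} (π : Equiv.Perm (Fin N)) (s : Finset ι)
    (T : ι → SuperOp N) : jwSuper π (∑ a ∈ s, T a) = ∑ a ∈ s, jwSuper π (T a) := by
  classical
  induction s using Finset.induction_on with
  | empty => simp [jwSuper_zero]
  | insert a s ha ih => rw [Finset.sum_insert ha, Finset.sum_insert ha, jwSuper_add, ih]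

theorem conjBy_apply {N : ℕ} (K ρ : Op N) : conjBy K ρ = K * ρ * Kᴴ := by
  simp [conjBy, LinearMap.mulLeftRight_apply]

theorem conjBy_comp {N : ℕ} (K L : Op N) : conjBy K ∘ₗ conjBy L = conjBy (K * L) := by
  ext1 ρ
  simp only [LinearMap.comp_apply, conjBy_apply, Matrix.conjTranspose_mul, mul_assoc]

theorem conjBy_one {N : ℕ} : conjBy (1 : Op N) = LinearMap.id := by
  ext1 ρ
  simp [conjBy_apply]

theorem jwSuper_conjBy {N : ℕ} (π : Equiv.Perm (Fin N)) (K : Op N) :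
    jwSuper π (conjBy K) = conjBy (jordanWigner π K) := by
  ext1 ρ
  simp [jwSuper, conjBy_apply, jordanWigner_mul, jordanWigner_jordanWigner,
    jordanWigner_conjTranspose]

/-! ### Strings of `σ_z` -/

/-- The product of the `x i`-th powers of the `σ_z`-strings of the parties `i`. -/
def zPow {n N : ℕ} (owner : Fin N → Fin n) (x : Fin n → ℕ) : Op N :=
  Matrix.diagonal fun s => ∏ j, occSign s j ^ x (owner j)

theorem zPow_add {n N : ℕ} (owner : Fin N → Fin n) (x y : Fin n → ℕ) :
    zPow owner (x + y) = zPow owner x * zPow owner y := by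
  simp [zPow, Matrix.diagonal_mul_diagonal, pow_add, Finset.prod_mul_distrib]

theorem zPow_zero {n N : ℕ} (owner : Fin N → Fin n) : zPow owner 0 = 1 := by
  simp [zPow]

/-- Since `σ_z` squares to `1`, exponents matter modulo `2`. Natural exponents allow counts of odd
outcomes to be inserted directly. -/
theorem zPow_congr {n N : ℕ} (owner : Fin N → Fin n) {x y : Fin n → ℕ}
    (h : ∀ i, x i % 2 = y i % 2) : zPow owner x = zPow owner y := by
  unfold zPow
  congr 1
  ext s
  refine Finset.prod_congr rfl fun j _ => ?_
  have e : ∀ m : ℕ, occSign s j ^ m = occSign s j ^ (m % 2) := by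
    intro m
    conv_lhs => rw [← Nat.div_add_mod m 2, pow_add, pow_mul, pow_two, occSign_mul_self]
    simp
  rw [e, h, ← e]

theorem zPow_mul_self {n N : ℕ} (owner : Fin N → Fin n) (x : Fin n → ℕ) :
    zPow owner x * zPow owner x = 1 := by
  rw [← zPow_add, ← zPow_zero owner]
  exact zPow_congr owner fun i => by simp only [Pi.add_apply, Pi.zero_apply]; omega

theorem conjTranspose_zPow {n N : ℕ} (owner : Fin N → Fin n) (x : Fin n → ℕ) :
    (zPow owner x)ᴴ = zPow owner x := by
  rw [zPow, Matrix.diagonal_conjTranspose]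
  congr 1
  ext s
  simp only [Pi.star_apply, star_prod, star_pow, star_occSign]

theorem jordanWigner_zPow {n N : ℕ} (owner : Fin N → Fin n) (π : Equiv.Perm (Fin N))
    (x : Fin n → ℕ) : jordanWigner π (zPow owner x) = zPow owner x :=
  jordanWigner_diagonal _ _

theorem zString_eq_zPow {n N : ℕ} (owner : Fin N → Fin n) (i : Fin n) :
    zString owner i = zPow owner (fun k => if k = i then 1 else 0) := by
  unfold zString zPow
  congr 1
  ext s
  rw [Finset.prod_filter]
  refine Finset.prod_congr rfl fun j _ => ?_
  by_cases h : owner j = i <;> simp [h, occSign]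

theorem zPow_mul_fermi {n N : ℕ} (owner : Fin N → Fin n) (x : Fin n → ℕ) (k : Fin N) :
    zPow owner x * fermi k = (-1 : ℂ) ^ x (owner k) • (fermi k * zPow owner x) := by
  ext s t
  rw [zPow, Matrix.diagonal_mul, Matrix.smul_apply, Matrix.mul_diagonal, fermi_apply]
  split_ifs with h
  · obtain ⟨h1, rfl⟩ := h
    have e : ∏ j, occSign t j ^ x (owner j) = (-1 : ℂ) ^ x (owner k) *
        ∏ j, occSign (Function.update t k false) j ^ x (owner j) := by
      rw [← Finset.mul_prod_erase _ _ (Finset.mem_univ k),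
        ← Finset.mul_prod_erase Finset.univ
          (fun j => occSign (Function.update t k false) j ^ x (owner j)) (Finset.mem_univ k)]
      have e1 : occSign t k = -1 := by simp [occSign, h1]
      have e2 : occSign (Function.update t k false) k = 1 := by simp [occSign]
      rw [e1, e2, one_pow, one_mul]
      congr 1
      refine Finset.prod_congr rfl fun j hj => ?_
      simp [occSign, Finset.ne_of_mem_erase hj]
    have e3 : (-1 : ℂ) ^ x (owner k) * (-1 : ℂ) ^ x (owner k) = 1 := by
      rw [← mul_pow]; simp
    rw [e, smul_eq_mul]
    linear_combination -(∏ j, (if j < k then occSign t j else 1)) *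
      (∏ j, occSign (Function.update t k false) j ^ x (owner j)) * e3
  · simp

theorem zPow_mul_fieldOp {n N : ℕ} (owner : Fin N → Fin n) (x : Fin n → ℕ) {i : Fin n} {X : Op N}
    (hX : X ∈ fieldOps (modesOf owner i)) :
    zPow owner x * X = (-1 : ℂ) ^ x i • (X * zPow owner x) := by
  obtain ⟨k, hk, rfl | rfl⟩ := hX
  · rw [zPow_mul_fermi, show owner k = i from hk]
  -- The strings are Hermitian, so the adjoint of the relation for `φ_k` is the one for `φ_k†` with
  -- the two sides exchanged; the sign is its own inverse.
  · have h := congrArg Matrix.conjTranspose (zPow_mul_fermi owner x k)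
    rw [Matrix.conjTranspose_smul, Matrix.conjTranspose_mul, Matrix.conjTranspose_mul,
      conjTranspose_zPow, show owner k = i from hk] at h
    rw [h, smul_smul]
    simp [← mul_pow]

theorem zPow_mul_list_prod {n N : ℕ} (owner : Fin N → Fin n) (x : Fin n → ℕ) {i : Fin n}
    (l : List (Op N)) (hl : ∀ X ∈ l, X ∈ fieldOps (modesOf owner i)) :
    zPow owner x * l.prod = (-1 : ℂ) ^ (x i * l.length) • (l.prod * zPow owner x) := by
  induction l with
  | nil => simp
  | cons X l ih =>
    rw [List.prod_cons, ← mul_assoc, zPow_mul_fieldOp owner x (hl X (by simp)), smul_mul_assoc,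
      mul_assoc, ih fun Y hY => hl Y (by simp [hY]), mul_smul_comm, smul_smul, ← mul_assoc,
      List.length_cons, ← pow_add]
    congr 2
    ring

theorem zPow_mul_of_mem_evenOps {n N : ℕ} (owner : Fin N → Fin n) (x : Fin n → ℕ) {i : Fin n}
    {K : Op N} (hK : K ∈ evenOps (modesOf owner i)) : zPow owner x * K = K * zPow owner x := by
  induction hK using Submodule.span_induction with
  | mem X h =>
    obtain ⟨l, hl, he, rfl⟩ := h
    rw [zPow_mul_list_prod owner x l hl, (he.mul_left _).neg_one_pow, one_smul]
  | zero => simp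
  | add X Y _ _ hX hY => rw [mul_add, add_mul, hX, hY]
  | smul a X _ hX => rw [mul_smul_comm, smul_mul_assoc, hX]

theorem zPow_mul_of_mem_oddOps {n N : ℕ} (owner : Fin N → Fin n) (x : Fin n → ℕ) {i : Fin n}
    {K : Op N} (hK : K ∈ oddOps (modesOf owner i)) :
    zPow owner x * K = (-1 : ℂ) ^ x i • (K * zPow owner x) := by
  induction hK using Submodule.span_induction with
  | mem X h =>
    obtain ⟨l, hl, ho, rfl⟩ := h
    rw [zPow_mul_list_prod owner x l hl, mul_comm, pow_mul, ho.neg_one_pow]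
  | zero => simp
  | add X Y _ _ hX hY => rw [mul_add, add_mul, hX, hY, smul_add]
  | smul a X _ hX => rw [mul_smul_comm, smul_mul_assoc, hX, smul_comm]

/-- An odd `K` may anticommute with the string, but the sign enters once through `K` and once
through `K†`. This is what permits corrections to be postponed. -/
theorem conjBy_zPow_comm {n N : ℕ} (owner : Fin N → Fin n) (x : Fin n → ℕ) {i : Fin n}
    {K : Op N} (hK : K ∈ fermionicKraus owner i) :
    conjBy (zPow owner x) ∘ₗ conjBy K = conjBy K ∘ₗ conjBy (zPow owner x) := by
  rw [conjBy_comp, conjBy_comp]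
  rcases hK with hK | hK
  · rw [zPow_mul_of_mem_evenOps owner x hK]
  · rw [zPow_mul_of_mem_oddOps owner x hK]
    ext1 ρ
    rw [conjBy_apply, conjBy_apply, Matrix.conjTranspose_smul, smul_mul_assoc, smul_mul_assoc,
      mul_smul_comm, smul_smul]
    simp [← mul_pow]

/-! ### Local qubit operators -/

/-- In the form `A ⊗ I` closure under sums, products and adjoints is read off from the rules for
Kronecker products. -/
theorem mem_qubitKraus_iff {n N : ℕ} (owner : Fin N → Fin n) (i : Fin n) [DecidableEq (Fin n)]
    (K : Op N) :
    K ∈ qubitKraus owner i ↔ ∃ A : Matrix ({j // owner j = i} → Bool) ({j // owner j = i} → Bool) ℂ,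
      K = (A ⊗ₖ (1 : Matrix ({j // ¬ owner j = i} → Bool) ({j // ¬ owner j = i} → Bool) ℂ)).submatrix
        (Equiv.piEquivPiSubtypeProd (fun j => owner j = i) fun _ => Bool)
        (Equiv.piEquivPiSubtypeProd (fun j => owner j = i) fun _ => Bool) := by
  have key : ∀ A : Matrix ({j // owner j = i} → Bool) ({j // owner j = i} → Bool) ℂ,
      (A ⊗ₖ (1 : Matrix ({j // ¬ owner j = i} → Bool) ({j // ¬ owner j = i} → Bool) ℂ)).submatrix
        (Equiv.piEquivPiSubtypeProd (fun j => owner j = i) fun _ => Bool)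
        (Equiv.piEquivPiSubtypeProd (fun j => owner j = i) fun _ => Bool) =
      fun s t => if ∀ j, owner j ≠ i → s j = t j then A (fun j => s j) (fun j => t j) else 0 := by
    intro A
    ext s t
    simp only [Matrix.submatrix_apply, Matrix.kroneckerMap_apply,
      Equiv.piEquivPiSubtypeProd_apply, Matrix.one_apply, funext_iff, Subtype.forall]
    split_ifs <;> simp
  constructor
  · rintro ⟨A, rfl⟩
    refine ⟨A, Eq.trans ?_ (key A).symm⟩
    ext s t
    congr
  · rintro ⟨A, rfl⟩
    refine ⟨A, (key A).trans ?_⟩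
    ext s t
    congr

theorem mem_modesOf {n N : ℕ} {owner : Fin N → Fin n} {i : Fin n} {j : Fin N} :
    j ∈ modesOf owner i ↔ owner j = i := Iff.rfl

/-- The operators on the qubits of the party `i`, as a subalgebra. -/
def localSubalgebra {n N : ℕ} (owner : Fin N → Fin n) (i : Fin n) : Subalgebra ℂ (Op N) where
  carrier := qubitKraus owner i
  mul_mem' {X Y} hX hY := by
    rw [mem_qubitKraus_iff] at *
    obtain ⟨A, rfl⟩ := hX
    obtain ⟨B, rfl⟩ := hY
    refine ⟨A * B, ?_⟩
    rw [Matrix.submatrix_mul_equiv, ← Matrix.mul_kronecker_mul, one_mul]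
  add_mem' {X Y} hX hY := by
    rw [mem_qubitKraus_iff] at *
    obtain ⟨A, rfl⟩ := hX
    obtain ⟨B, rfl⟩ := hY
    refine ⟨A + B, ?_⟩
    rw [Matrix.add_kronecker, Matrix.submatrix_add]
    rfl
  algebraMap_mem' c := by
    rw [mem_qubitKraus_iff]
    refine ⟨c • 1, ?_⟩
    rw [Matrix.smul_kronecker, Matrix.one_kronecker_one, Matrix.submatrix_smul,
      Algebra.algebraMap_eq_smul_one]
    simp

theorem mem_localSubalgebra {n N : ℕ} {owner : Fin N → Fin n} {i : Fin n} {K : Op N} :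
    K ∈ localSubalgebra owner i ↔ K ∈ qubitKraus owner i := Iff.rfl

theorem conjTranspose_mem_localSubalgebra {n N : ℕ} {owner : Fin N → Fin n} {i : Fin n}
    {K : Op N} (hK : K ∈ localSubalgebra owner i) : Kᴴ ∈ localSubalgebra owner i := by
  rw [mem_localSubalgebra, mem_qubitKraus_iff] at *
  obtain ⟨A, rfl⟩ := hK
  refine ⟨Aᴴ, ?_⟩
  rw [Matrix.conjTranspose_submatrix, Matrix.conjTranspose_kronecker, Matrix.conjTranspose_one]

theorem zPow_single_mem {n N : ℕ} (owner : Fin N → Fin n) (i : Fin n) (m : ℕ) :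
    zPow owner (fun k => if k = i then m else 0) ∈ qubitKraus owner i := by
  classical
  refine ⟨Matrix.diagonal fun a => ∏ j, (if a j = true then (-1 : ℂ) else 1) ^ m, ?_⟩
  ext s t
  by_cases h : s = t
  · subst h
    simp only [zPow, Matrix.diagonal_apply_eq, implies_true, if_true]
    have e : ∀ j, occSign s j ^ (if owner j = i then m else 0) =
        if j ∈ modesOf owner i then occSign s j ^ m else 1 := by
      intro j; simp only [mem_modesOf]; split_ifs <;> simp
    rw [Finset.prod_congr rfl fun j _ => e j, ← Finset.prod_filter]
    exact Finset.prod_subtype _ (by simp) _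
  · rw [zPow, Matrix.diagonal_apply_ne _ h]
    split_ifs with h2
    · rw [Matrix.diagonal_apply_ne]
      intro h3
      apply h
      ext j
      by_cases hj : j ∈ modesOf owner i
      · exact congrFun h3 ⟨j, hj⟩
      · exact h2 j hj
    · rfl

/-! ### Jordan-Wigner images of local Fermionic operators -/

/-- The exponents of the `σ_z`-string of all parties before `i`. -/
def before {n : ℕ} (i : Fin n) : Fin n → ℕ := fun k => if k < i then 1 else 0

/-- Monotonicity forces all modes of earlier parties to precede `k` and all modes of later parties
to follow it. The prefactor cancels the signs of the former, and only a string on the owner's own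
modes remains. -/
theorem zPow_before_mul_jordanWigner_fermi {n N : ℕ} {owner : Fin N → Fin n}
    {π : Equiv.Perm (Fin N)} (hπ : Monotone (owner ∘ π)) (k : Fin N) :
    zPow owner (before (owner k)) * jordanWigner π (fermi k) ∈ localSubalgebra owner (owner k) := by
  classical
  have hk : k ∈ modesOf owner (owner k) := rfl
  refine ⟨fun a b => if b ⟨k, hk⟩ = true ∧ a = Function.update b ⟨k, hk⟩ false then
      ∏ j : modesOf owner (owner k), (if π.symm j < π.symm k then
        (if b j = true then (-1 : ℂ) else 1) else 1) else 0, ?_⟩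
  ext s t
  beta_reduce
  rw [zPow, Matrix.diagonal_mul, jordanWigner_fermi_apply]
  -- The support condition splits into agreement on foreign qubits, which is the factor `I`, and
  -- removal of `k` on the party's own qubits, which belongs to `A`.
  have hcond : (t k = true ∧ s = Function.update t k false) ↔
      ((∀ j, j ∉ modesOf owner (owner k) → s j = t j) ∧ t k = true ∧
        (fun j : modesOf owner (owner k) => s j) =
          Function.update (fun j : modesOf owner (owner k) => t j) ⟨k, hk⟩ false) := by
    constructor
    · rintro ⟨h1, rfl⟩
      refine ⟨fun j hj => ?_, h1, ?_⟩
      · rw [Function.update_of_ne]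
        rintro rfl
        exact hj rfl
      · ext j
        by_cases hj : (j : Fin N) = k
        · have : j = ⟨k, hk⟩ := Subtype.ext hj
          subst this; simp
        · rw [Function.update_of_ne hj, Function.update_of_ne fun h => hj (congrArg Subtype.val h)]
    · rintro ⟨h1, h2, h3⟩
      refine ⟨h2, ?_⟩
      ext j
      by_cases hj : j ∈ modesOf owner (owner k)
      · have h4 := congrFun h3 ⟨j, hj⟩
        by_cases hjk : j = k
        · subst hjk; simpa using h4
        · rw [Function.update_of_ne hjk]
          rw [Function.update_of_ne fun h => hjk (congrArg Subtype.val h)] at h4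
          exact h4
      · rw [h1 j hj, Function.update_of_ne]
        rintro rfl
        exact hj rfl
  by_cases hc : t k = true ∧ s = Function.update t k false
  · rw [if_pos hc]
    have hc' := hcond.1 hc
    rw [if_pos hc'.1, if_pos hc'.2, ← Finset.prod_mul_distrib]
    have e : ∏ j : modesOf owner (owner k), (if π.symm j < π.symm k then
        (if t j = true then (-1 : ℂ) else 1) else 1) =
        ∏ j, if j ∈ modesOf owner (owner k) then
          (if π.symm j < π.symm k then occSign t j else 1) else 1 := by
      refine Eq.trans (Eq.symm ?_) (Finset.prod_filter (· ∈ modesOf owner (owner k)) _)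
      exact Finset.prod_subtype _ (by simp) _
    rw [e]
    refine Finset.prod_congr rfl fun j _ => ?_
    have hle : π.symm j ≤ π.symm k → owner j ≤ owner k := fun h => by simpa using hπ h
    have hge : π.symm k ≤ π.symm j → owner k ≤ owner j := fun h => by simpa using hπ h
    simp only [mem_modesOf, before]
    -- At a mode of an earlier party the two signs cancel, since `s` and `t` agree there; at an own
    -- mode only the sign of `A` occurs; at a mode of a later party there is none.
    rcases lt_trichotomy (owner j) (owner k) with h | h | h
    · have h1 : π.symm j < π.symm k := lt_of_not_ge fun h' => absurd (hge h') h.not_ge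
      have h2 : s j = t j := by
        rw [hc.2, Function.update_of_ne]
        rintro rfl
        exact lt_irrefl _ h
      have h3 : occSign s j = occSign t j := by simp [occSign, h2]
      rw [if_pos h, if_pos h1, if_neg h.ne, pow_one, h3, occSign_mul_self]
    · simp [h]
    · have h1 : ¬ π.symm j < π.symm k := fun h' => absurd (hle h'.le) h.not_ge
      rw [if_neg h.not_gt, if_neg h1, if_neg h.ne']
      simp
  · rw [if_neg hc, mul_zero]
    split_ifs with h1 h2
    · exact absurd (hcond.2 ⟨h1, h2⟩) hc
    · rfl
    · rfl

theorem zPow_before_mul_jordanWigner_fieldOp {n N : ℕ} {owner : Fin N → Fin n}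
    {π : Equiv.Perm (Fin N)} (hπ : Monotone (owner ∘ π)) {i : Fin n} {X : Op N}
    (hX : X ∈ fieldOps (modesOf owner i)) :
    zPow owner (before i) * jordanWigner π X ∈ localSubalgebra owner i := by
  obtain ⟨k, hk, rfl | rfl⟩ := hX
  · obtain rfl : owner k = i := hk
    exact zPow_before_mul_jordanWigner_fermi hπ k
  · obtain rfl : owner k = i := hk
    have h := conjTranspose_mem_localSubalgebra (zPow_before_mul_jordanWigner_fermi hπ k)
    rw [Matrix.conjTranspose_mul, conjTranspose_zPow, ← jordanWigner_conjTranspose] at h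
    -- Taking the adjoint puts the string on the right. It can be moved back without a sign, because
    -- `before` vanishes at the party itself.
    have hf : (fermi k)ᴴ ∈ fieldOps (modesOf owner (owner k)) := ⟨k, rfl, Or.inr rfl⟩
    have h2 := congrArg (jordanWigner π) (zPow_mul_fieldOp owner (before (owner k)) hf)
    rw [jordanWigner_mul, jordanWigner_zPow] at h2
    rw [h2]
    simpa [before, jordanWigner_mul, jordanWigner_zPow] using h

theorem zPow_before_pow_mul_jordanWigner_prod {n N : ℕ} {owner : Fin N → Fin n}
    {π : Equiv.Perm (Fin N)} (hπ : Monotone (owner ∘ π)) {i : Fin n} (l : List (Op N))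
    (hl : ∀ X ∈ l, X ∈ fieldOps (modesOf owner i)) :
    zPow owner (l.length • before i) * jordanWigner π l.prod ∈ localSubalgebra owner i := by
  induction l with
  | nil => simp [zPow_zero, jordanWigner_one, one_mem]
  | cons X l ih =>
    have hX := zPow_before_mul_jordanWigner_fieldOp hπ (hl X (by simp))
    have ih := ih fun Y hY => hl Y (by simp [hY])
    -- The accumulated string involves only earlier parties, so it passes the next factor and merges
    -- with the string of that factor.
    have hcomm : zPow owner (l.length • before i) * X = X * zPow owner (l.length • before i) := by
      rw [zPow_mul_fieldOp owner _ (hl X (by simp))]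
      simp [before]
    have hcomm := congrArg (jordanWigner π) hcomm
    rw [jordanWigner_mul, jordanWigner_mul, jordanWigner_zPow] at hcomm
    have h := mul_mem hX ih
    rw [mul_assoc, ← mul_assoc (jordanWigner π X), ← hcomm, mul_assoc, ← mul_assoc, ← zPow_add,
      ← jordanWigner_mul] at h
    rw [List.length_cons, List.prod_cons, succ_nsmul']
    exact h

theorem jordanWigner_add {N : ℕ} (π : Equiv.Perm (Fin N)) (X Y : Op N) :
    jordanWigner π (X + Y) = jordanWigner π X + jordanWigner π Y := by
  simp [← jwMap_apply]

theorem jordanWigner_smul {N : ℕ} (π : Equiv.Perm (Fin N)) (c : ℂ) (X : Op N) :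
    jordanWigner π (c • X) = c • jordanWigner π X := by
  simp [← jwMap_apply]

theorem jordanWigner_zero {N : ℕ} (π : Equiv.Perm (Fin N)) :
    jordanWigner π (0 : Op N) = 0 := by
  simp [← jwMap_apply]

theorem jordanWigner_mem_of_mem_evenOps {n N : ℕ} {owner : Fin N → Fin n}
    {π : Equiv.Perm (Fin N)} (hπ : Monotone (owner ∘ π)) {i : Fin n} {K : Op N}
    (hK : K ∈ evenOps (modesOf owner i)) : jordanWigner π K ∈ qubitKraus owner i := by
  rw [← mem_localSubalgebra]
  induction hK using Submodule.span_induction with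
  | mem X h =>
    obtain ⟨l, hl, he, rfl⟩ := h
    have h := zPow_before_pow_mul_jordanWigner_prod hπ l hl
    have e : zPow owner (l.length • before i) = 1 := by
      rw [← zPow_zero owner]
      refine zPow_congr owner fun k => ?_
      simp [Nat.even_iff.1 he, Nat.mul_mod]
    rwa [e, one_mul] at h
  | zero => simp [jordanWigner_zero]
  | add X Y _ _ hX hY => rw [jordanWigner_add]; exact add_mem hX hY
  | smul a X _ hX => rw [jordanWigner_smul]; exact Subalgebra.smul_mem _ hX a

theorem zPow_before_mul_mem_of_mem_oddOps {n N : ℕ} {owner : Fin N → Fin n}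
    {π : Equiv.Perm (Fin N)} (hπ : Monotone (owner ∘ π)) {i : Fin n} {K : Op N}
    (hK : K ∈ oddOps (modesOf owner i)) :
    zPow owner (before i) * jordanWigner π K ∈ qubitKraus owner i := by
  rw [← mem_localSubalgebra]
  induction hK using Submodule.span_induction with
  | mem X h =>
    obtain ⟨l, hl, ho, rfl⟩ := h
    have h := zPow_before_pow_mul_jordanWigner_prod hπ l hl
    have e : zPow owner (l.length • before i) = zPow owner (before i) := by
      refine zPow_congr owner fun k => ?_
      simp [Nat.odd_iff.1 ho, Nat.mul_mod]
    rwa [e] at h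
  | zero => simp [jordanWigner_zero]
  | add X Y _ _ hX hY => rw [jordanWigner_add, mul_add]; exact add_mem hX hY
  | smul a X _ hX =>
    rw [jordanWigner_smul, mul_smul_comm]; exact Subalgebra.smul_mem _ hX a

/-! ### Transformations -/

/-- Concatenating Kraus families adds the maps. In this form the decomposition by parity is an
induction over an additive closure. -/
theorem isTransformation_iff_mem_closure {N : ℕ} (L : Set (Op N)) (T : SuperOp N) :
    IsTransformation L T ↔ T ∈ AddSubmonoid.closure (conjBy '' L) := by
  constructor
  · rintro ⟨m, K, hK, rfl⟩
    exact sum_mem fun a _ => AddSubmonoid.subset_closure ⟨K a, hK a, rfl⟩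
  · intro h
    induction h using AddSubmonoid.closure_induction with
    | mem T h =>
      obtain ⟨K, hK, rfl⟩ := h
      exact ⟨1, fun _ => K, fun _ => hK, by simp⟩
    | zero => exact ⟨0, Fin.elim0, fun a => a.elim0, by simp⟩
    | add T T' _ _ hT hT' =>
      obtain ⟨m, K, hK, rfl⟩ := hT
      obtain ⟨m', K', hK', rfl⟩ := hT'
      refine ⟨m + m', Fin.append K K', fun a => ?_, ?_⟩
      · refine Fin.addCases (fun b => ?_) (fun b => ?_) a
        · rw [Fin.append_left]; exact hK b
        · rw [Fin.append_right]; exact hK' b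
      · simp [Fin.sum_univ_add]

theorem IsTransformation.map {N : ℕ} {L L' : Set (Op N)} (F : SuperOp N →+ SuperOp N)
    (hF : ∀ K ∈ L, ∃ K' ∈ L', F (conjBy K) = conjBy K') {T : SuperOp N}
    (hT : IsTransformation L T) : IsTransformation L' (F T) := by
  obtain ⟨m, K, hK, rfl⟩ := hT
  choose K' hK' e using fun a => hF (K a) (hK a)
  exact ⟨m, K', hK', by simp [e]⟩

/-! ### Splitting by parity and the refined tests -/

theorem IsTransformation.exists_even_add_odd {n N : ℕ} {owner : Fin N → Fin n} {i : Fin n}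
    {T : SuperOp N} (hT : IsTransformation (fermionicKraus owner i) T) :
    ∃ E O : SuperOp N, IsTransformation (evenOps (modesOf owner i) : Set (Op N)) E ∧
      IsTransformation (oddOps (modesOf owner i) : Set (Op N)) O ∧ T = E + O := by
  simp only [isTransformation_iff_mem_closure] at *
  induction hT using AddSubmonoid.closure_induction with
  | mem T h =>
    obtain ⟨K, hK | hK, rfl⟩ := h
    · exact ⟨_, 0, AddSubmonoid.subset_closure ⟨K, hK, rfl⟩, zero_mem _, (add_zero _).symm⟩
    · exact ⟨0, _, zero_mem _, AddSubmonoid.subset_closure ⟨K, hK, rfl⟩, (zero_add _).symm⟩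
  | zero => exact ⟨0, 0, zero_mem _, zero_mem _, (add_zero _).symm⟩
  | add T T' _ _ hT hT' =>
    obtain ⟨E, O, hE, hO, rfl⟩ := hT
    obtain ⟨E', O', hE', hO', rfl⟩ := hT'
    exact ⟨E + E', O + O', add_mem hE hE', add_mem hO hO', add_add_add_comm _ _ _ _⟩

theorem IsTransformation.mono {N : ℕ} {L L' : Set (Op N)} (h : L ⊆ L') {T : SuperOp N}
    (hT : IsTransformation L T) : IsTransformation L' T := by
  obtain ⟨m, K, hK, rfl⟩ := hT
  exact ⟨m, K, fun a => h (hK a), rfl⟩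

theorem evenOps_subset_fermionicKraus {n N : ℕ} (owner : Fin N → Fin n) (i : Fin n) :
    (evenOps (modesOf owner i) : Set (Op N)) ⊆ fermionicKraus owner i := fun _ h => Or.inl h

theorem oddOps_subset_fermionicKraus {n N : ℕ} (owner : Fin N → Fin n) (i : Fin n) :
    (oddOps (modesOf owner i) : Set (Op N)) ⊆ fermionicKraus owner i := fun _ h => Or.inr h

open Classical in
/-- The part with even Kraus operators of a Fermionic transformation of the party `i`. -/
def evenPart {n N : ℕ} (owner : Fin N → Fin n) (i : Fin n) (T : SuperOp N) : SuperOp N :=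
  if h : IsTransformation (fermionicKraus owner i) T then h.exists_even_add_odd.choose else 0

open Classical in
/-- The part with odd Kraus operators of a Fermionic transformation of the party `i`. -/
def oddPart {n N : ℕ} (owner : Fin N → Fin n) (i : Fin n) (T : SuperOp N) : SuperOp N :=
  if h : IsTransformation (fermionicKraus owner i) T then
    h.exists_even_add_odd.choose_spec.choose else 0

theorem evenPart_oddPart_spec {n N : ℕ} {owner : Fin N → Fin n} {i : Fin n} {T : SuperOp N}
    (h : IsTransformation (fermionicKraus owner i) T) :
    IsTransformation (evenOps (modesOf owner i) : Set (Op N)) (evenPart owner i T) ∧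
      IsTransformation (oddOps (modesOf owner i) : Set (Op N)) (oddPart owner i T) ∧
      T = evenPart owner i T + oddPart owner i T := by
  rw [evenPart, oddPart, dif_pos h, dif_pos h]
  exact h.exists_even_add_odd.choose_spec.choose_spec

/-- `jwSuper` as an additive map. -/
def jwSuperHom {N : ℕ} (π : Equiv.Perm (Fin N)) : SuperOp N →+ SuperOp N where
  toFun := jwSuper π
  map_zero' := jwSuper_zero π
  map_add' := jwSuper_add π

theorem IsTransformation.jwSuper_even {n N : ℕ} {owner : Fin N → Fin n} {π : Equiv.Perm (Fin N)}
    (hπ : Monotone (owner ∘ π)) {i : Fin n} {T : SuperOp N}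
    (hT : IsTransformation (evenOps (modesOf owner i) : Set (Op N)) T) :
    IsTransformation (qubitKraus owner i) (jwSuper π T) :=
  hT.map (jwSuperHom π) fun K hK =>
    ⟨_, jordanWigner_mem_of_mem_evenOps hπ hK, jwSuper_conjBy π K⟩

theorem comp_finsetSum {N : ℕ} {ι : Type*} (T : SuperOp N) (s : Finset ι) (F : ι → SuperOp N) :
    T ∘ₗ (∑ a ∈ s, F a) = ∑ a ∈ s, T ∘ₗ F a := by
  ext1 ρ
  simp

theorem finsetSum_comp {N : ℕ} {ι : Type*} (T : SuperOp N) (s : Finset ι) (F : ι → SuperOp N) :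
    (∑ a ∈ s, F a) ∘ₗ T = ∑ a ∈ s, F a ∘ₗ T := by
  ext1 ρ
  simp

/-- Removing the string on the earlier parties leaves something that party `i` can perform alone;
the earlier parties have to restore it. -/
theorem IsTransformation.jwSuper_odd {n N : ℕ} {owner : Fin N → Fin n} {π : Equiv.Perm (Fin N)}
    (hπ : Monotone (owner ∘ π)) {i : Fin n} {T : SuperOp N}
    (hT : IsTransformation (oddOps (modesOf owner i) : Set (Op N)) T) :
    IsTransformation (qubitKraus owner i) (conjBy (zPow owner (before i)) ∘ₗ jwSuper π T) := by
  obtain ⟨m, K, hK, rfl⟩ := hT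
  refine ⟨m, _, fun a => zPow_before_mul_mem_of_mem_oddOps hπ (hK a), ?_⟩
  rw [jwSuper_sum, comp_finsetSum]
  exact Finset.sum_congr rfl fun a _ => by rw [jwSuper_conjBy, conjBy_comp]

theorem IsTransformation.zPow_comm {n N : ℕ} {owner : Fin N → Fin n} (π : Equiv.Perm (Fin N))
    {i : Fin n} {T : SuperOp N} (hT : IsTransformation (fermionicKraus owner i) T)
    (x : Fin n → ℕ) :
    conjBy (zPow owner x) ∘ₗ jwSuper π T = jwSuper π T ∘ₗ conjBy (zPow owner x) := by
  obtain ⟨m, K, hK, rfl⟩ := hT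
  have h : conjBy (zPow owner x) ∘ₗ (∑ a, conjBy (K a)) =
      (∑ a, conjBy (K a)) ∘ₗ conjBy (zPow owner x) := by
    rw [comp_finsetSum, finsetSum_comp]
    exact Finset.sum_congr rfl fun a _ => conjBy_zPow_comm owner x (hK a)
  have h2 := congrArg (jwSuper π) h
  rwa [jwSuper_comp, jwSuper_comp, jwSuper_conjBy π (zPow owner x), jordanWigner_zPow] at h2

theorem trace_conjBy_zPow {n N : ℕ} (owner : Fin N → Fin n) (x : Fin n → ℕ) (ρ : Op N) :
    (conjBy (zPow owner x) ρ).trace = ρ.trace := by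
  rw [conjBy_apply, Matrix.trace_mul_comm, ← mul_assoc, conjTranspose_zPow, zPow_mul_self, one_mul]

/-- The test of the qubit protocol that simulates the Fermionic test `T` of the party `i`: the
outcome `2 * a` stands for the even and the outcome `2 * a + 1` for the odd part of `T a`. -/
def refinedTest {n N : ℕ} (owner : Fin N → Fin n) (π : Equiv.Perm (Fin N)) (i : Fin n)
    (T : ℕ → SuperOp N) (b : ℕ) : SuperOp N :=
  if b % 2 = 0 then jwSuper π (evenPart owner i (T (b / 2)))
  else conjBy (zPow owner (before i)) ∘ₗ jwSuper π (oddPart owner i (T (b / 2)))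

theorem refinedTest_even {n N : ℕ} (owner : Fin N → Fin n) (π : Equiv.Perm (Fin N)) (i : Fin n)
    (T : ℕ → SuperOp N) (a : ℕ) :
    refinedTest owner π i T (2 * a) = jwSuper π (evenPart owner i (T a)) := by
  simp [refinedTest]

theorem refinedTest_odd {n N : ℕ} (owner : Fin N → Fin n) (π : Equiv.Perm (Fin N)) (i : Fin n)
    (T : ℕ → SuperOp N) (a : ℕ) :
    refinedTest owner π i T (2 * a + 1) =
      conjBy (zPow owner (before i)) ∘ₗ jwSuper π (oddPart owner i (T a)) := by
  have h1 : (2 * a + 1) % 2 = 1 := by omega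
  have h2 : (2 * a + 1) / 2 = a := by omega
  simp [refinedTest, h1, h2]

theorem sum_range_two_mul {M : Type*} [AddCommMonoid M] (g : ℕ → M) (k : ℕ) :
    ∑ b ∈ Finset.range (2 * k), g b = ∑ a ∈ Finset.range k, (g (2 * a) + g (2 * a + 1)) := by
  induction k with
  | zero => simp
  | succ k ih =>
    rw [Nat.mul_succ, Finset.sum_range_succ, Finset.sum_range_succ, Finset.sum_range_succ, ih,
      add_assoc]

theorem isTest_refinedTest {n N : ℕ} {owner : Fin N → Fin n} {π : Equiv.Perm (Fin N)}
    (hπ : Monotone (owner ∘ π)) {i : Fin n} {k : ℕ} {T : ℕ → SuperOp N}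
    (hT : IsTest (fermionicKraus owner i) k T) :
    IsTest (qubitKraus owner i) (2 * k) (refinedTest owner π i T) := by
  constructor
  · intro b hb
    obtain ⟨hE, hO, -⟩ := evenPart_oddPart_spec (hT.1 (b / 2) (by omega))
    unfold refinedTest
    split_ifs
    · exact hE.jwSuper_even hπ
    · exact hO.jwSuper_odd hπ
  · intro ρ
    rw [← trace_jordanWigner π ρ, ← hT.2 (jordanWigner π ρ), sum_range_two_mul, Matrix.trace_sum, Matrix.trace_sum]
    refine Finset.sum_congr rfl fun a ha => ?_
    obtain ⟨-, -, h⟩ := evenPart_oddPart_spec (hT.1 a (Finset.mem_range.1 ha))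
    -- The string is unitary, so stripping it from the odd part does not change the trace.
    rw [refinedTest_even, refinedTest_odd, Matrix.trace_add, LinearMap.comp_apply,
      trace_conjBy_zPow, ← Matrix.trace_add, ← LinearMap.add_apply, ← jwSuper_add, ← h, jwSuper]
    simp [trace_jordanWigner]

/-- The parties before the first one do not exist, so that its Fermionic tests need not be
refined. -/
theorem isTest_jwSuper {n N : ℕ} {owner : Fin N → Fin n} {π : Equiv.Perm (Fin N)}
    (hπ : Monotone (owner ∘ π)) {i : Fin n} (hi : ∀ j, ¬ j < i) {k : ℕ} {T : ℕ → SuperOp N}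
    (hT : IsTest (fermionicKraus owner i) k T) :
    IsTest (qubitKraus owner i) k fun a => jwSuper π (T a) := by
  constructor
  · intro a ha
    refine (hT.1 a ha).map (jwSuperHom π) fun K hK => ⟨_, ?_, jwSuper_conjBy π K⟩
    rcases hK with hK | hK
    · exact jordanWigner_mem_of_mem_evenOps hπ hK
    · have h := zPow_before_mul_mem_of_mem_oddOps hπ hK
      have e : before i = 0 := by ext j; simp [before, hi j]
      rwa [e, zPow_zero, one_mul] at h
  · intro ρ
    rw [← trace_jordanWigner π ρ, ← hT.2 (jordanWigner π ρ), Matrix.trace_sum, Matrix.trace_sum]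
    refine Finset.sum_congr rfl fun a _ => ?_
    simp [jwSuper, trace_jordanWigner]

theorem isTest_one {N : ℕ} {L : Set (Op N)} {T : ℕ → SuperOp N} {K : Op N} (hK : K ∈ L)
    (hu : Kᴴ * K = 1) (hT : T 0 = conjBy K) : IsTest L 1 T := by
  constructor
  · intro a ha
    obtain rfl : a = 0 := by omega
    exact ⟨1, fun _ => K, fun _ => hK, by simp [hT]⟩
  · intro ρ
    rw [Finset.sum_range_one, hT, conjBy_apply, Matrix.trace_mul_comm, ← mul_assoc, hu, one_mul]

/-! ### Running a protocol -/

/-- The sum over all branches of the protocol of the transformation of the branch, followed by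
`F w`, where `w` are the final records of the branch. -/
def run {n N : ℕ} : Protocol n N → (Fin n → View n) → ((Fin n → View n) → SuperOp N) → SuperOp N
  | [], v, F => F v
  | r :: P, v, F => ∑ a ∈ Finset.range r.outcomes, run P (r.next v a) F ∘ₗ r.test (v r.party) a

theorem event_append {n N : ℕ} (P P' : Protocol n N) (v : Fin n → View n)
    (S : Set (Fin n → View n)) : event (P ++ P') v S = run P v fun w => event P' w S := by
  induction P generalizing v with
  | nil => rfl
  | cons r P ih =>
    rw [List.cons_append, event, run]
    exact Finset.sum_congr rfl fun a _ => by rw [ih]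

theorem length_next {n N : ℕ} (r : Round n N) (v : Fin n → View n) (a : ℕ) (i : Fin n) :
    (r.next v a i).length = (v i).length + 1 := by
  unfold Round.next; split_ifs <;> simp

/-- Every round adds exactly one entry to every record, possibly an empty message, so only final
records of one known length have to be compared. -/
theorem run_congr {n N : ℕ} (P : Protocol n N) {v : Fin n → View n} {m : ℕ}
    (hv : ∀ i, (v i).length = m) {F G : (Fin n → View n) → SuperOp N}
    (h : ∀ w : Fin n → View n, (∀ i, (w i).length = m + P.length) → F w = G w) :
    run P v F = run P v G := by
  induction P generalizing v m with
  | nil => exact h v (by simpa using hv)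
  | cons r P ih =>
    unfold run
    refine Finset.sum_congr rfl fun a _ => ?_
    rw [ih (m := m + 1) (fun i => by rw [length_next, hv]) fun w hw => h w fun i => by
      rw [hw, List.length_cons]; omega]

/-! ### Amount of communication -/

theorem linkBits_append {n N : ℕ} (P P' : Protocol n N) (i j : Fin n) :
    linkBits (P ++ P') i j = linkBits P i j + linkBits P' i j := by
  simp [linkBits]

theorem linkBits_cons {n N : ℕ} (r : Round n N) (P : Protocol n N) (i j : Fin n) :
    linkBits (r :: P) i j = (if r.party = i ∧ j ≠ i then r.bits j else 0) + linkBits P i j := by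
  simp [linkBits]

theorem totalBits_append {n N : ℕ} (P P' : Protocol n N) :
    totalBits (P ++ P') = totalBits P + totalBits P' := by
  simp [totalBits, linkBits_append, Finset.sum_add_distrib]

theorem sum_sum_pred (n : ℕ) :
    ∑ i : Fin n, ∑ j : Fin n, (if j.val + 1 = i.val then 1 else 0) = n - 1 := by
  cases n with
  | zero => simp
  | succ k =>
    rw [Fin.sum_univ_succ]
    have h : ∀ i : Fin k, ∑ j : Fin (k + 1), (if j.val + 1 = i.succ.val then 1 else 0) = 1 := by
      intro i
      rw [Finset.sum_eq_single i.castSucc]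
      · simp
      · intro j _ hj
        rw [if_neg]
        intro h
        apply hj
        ext
        simpa using h
      · simp
    rw [Finset.sum_congr rfl fun i _ => h i]
    simp

/-! ### Simulation with delayed corrections -/

/-- The outcome `2 * a` or `2 * a + 1` of a refined test is read as the outcome `a`. -/
def Entry.halve {n : ℕ} : Entry n → Entry n
  | .outcome b => .outcome (b / 2)
  | .message i m => .message i m

/-- The entry is the outcome of an odd Kraus operator. -/
def Entry.isOdd {n : ℕ} : Entry n → Bool
  | .outcome b => b % 2 == 1
  | .message _ _ => false

/-- The number of odd Kraus operators in a record. -/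
def oddCount {n : ℕ} (u : View n) : ℕ := u.countP Entry.isOdd

theorem oddCount_append_outcome {n : ℕ} (u : View n) (b : ℕ) :
    oddCount (u ++ [Entry.outcome b]) = oddCount u + b % 2 := by
  rcases Nat.mod_two_eq_zero_or_one b with h | h <;> simp [oddCount, Entry.isOdd, h]

theorem oddCount_append_message {n : ℕ} (u : View n) (i : Fin n) (m : List Bool) :
    oddCount (u ++ [Entry.message i m]) = oddCount u := by
  simp [oddCount, Entry.isOdd]

theorem oddCount_next {n N : ℕ} (r : Round n N) (u : Fin n → View n) (b : ℕ) (i : Fin n) :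
    oddCount (r.next u b i) = oddCount (u i) + if i = r.party then b % 2 else 0 := by
  unfold Round.next
  split_ifs
  · exact oddCount_append_outcome _ _
  · exact oddCount_append_message _ _ _

/-- The number of odd Kraus operators of the parties after `i`, each of which calls for the string
of `σ_z` on the qubits of the party `i`. -/
def needed {n : ℕ} (u : Fin n → View n) (i : Fin n) : ℕ := ∑ j, if i < j then oddCount (u j) else 0

/-- An odd outcome, and only an odd one, adds one string for each party before the acting one. -/
theorem needed_next {n N : ℕ} (r : Round n N) (u : Fin n → View n) (b : ℕ) :
    needed (r.next u b) = needed u + (b % 2) • before r.party := by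
  ext i
  simp only [needed, Pi.add_apply, Pi.smul_apply, before, smul_eq_mul]
  have h : ∀ j, (if i < j then oddCount (r.next u b j) else 0) =
      (if i < j then oddCount (u j) else 0) +
        if j = r.party then (if i < j then b % 2 else 0) else 0 := by
    intro j
    rw [oddCount_next]
    split_ifs <;> simp
  rw [Finset.sum_congr rfl fun j _ => h j, Finset.sum_add_distrib, Finset.sum_ite_eq' Finset.univ]
  simp

/-- The round of the qubit protocol that simulates the Fermionic round `r`, up to corrections. -/
def refinedRound {n N : ℕ} (owner : Fin N → Fin n) (π : Equiv.Perm (Fin N)) (r : Round n N) :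
    Round n N where
  party := r.party
  outcomes := 2 * r.outcomes
  test u := refinedTest owner π r.party (r.test (u.map Entry.halve))
  bits := r.bits
  msg j u := r.msg j (u.map Entry.halve)

theorem halve_refinedRound_next {n N : ℕ} (owner : Fin N → Fin n) (π : Equiv.Perm (Fin N))
    (r : Round n N) (u : Fin n → View n) (b : ℕ) :
    (fun i => ((refinedRound owner π r).next u b i).map Entry.halve) =
      r.next (fun i => (u i).map Entry.halve) (b / 2) := by
  ext1 i
  unfold Round.next
  by_cases h : i = r.party
  · simp [refinedRound, h, Entry.halve]
  · simp [refinedRound, h, Entry.halve, Round.message]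

-- The invariant of the delayed simulation: running the refined rounds and then all corrections
-- equals the corrections already due at the start, followed by the exact image of the Fermionic
-- event.
open Classical in
theorem run_refinedRounds {n N : ℕ} (owner : Fin N → Fin n) (π : Equiv.Perm (Fin N))
    (P : Protocol n N) (hP : IsFermionicLOCC owner P) (S : Set (Fin n → View n))
    (u : Fin n → View n) :
    (run (P.map (refinedRound owner π)) u fun w =>
      if (fun i => (w i).map Entry.halve) ∈ S then conjBy (zPow owner (needed w)) else 0) =
    jwSuper π (event P (fun i => (u i).map Entry.halve) S) ∘ₗ conjBy (zPow owner (needed u)) := by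
  induction P generalizing u with
  | nil =>
    simp only [List.map_nil, run, event]
    split_ifs
    · rw [jwSuper_id, LinearMap.id_comp]
    · rw [jwSuper_zero, LinearMap.zero_comp]
  | cons r P ih =>
    have ih := ih fun r' hr' => hP r' (List.mem_cons_of_mem _ hr')
    have hr := hP r List.mem_cons_self ((u r.party).map Entry.halve)
    rw [List.map_cons, run, event, jwSuper_sum, finsetSum_comp]
    refine (sum_range_two_mul _ _).trans (Finset.sum_congr rfl fun a ha => ?_)
    obtain ⟨hE, hO, hsum⟩ := evenPart_oddPart_spec (hr.1 a (Finset.mem_range.1 ha))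
    rw [ih, ih, halve_refinedRound_next, halve_refinedRound_next, needed_next, needed_next]
    have h1 : (2 * a) / 2 = a := by omega
    have h2 : (2 * a + 1) / 2 = a := by omega
    have h3 : (2 * a) % 2 = 0 := by omega
    have h4 : (2 * a + 1) % 2 = 1 := by omega
    have e0 : (refinedRound owner π r).test (u (refinedRound owner π r).party) =
      refinedTest owner π r.party (r.test ((u r.party).map Entry.halve)) := rfl
    have e1 : (refinedRound owner π r).party = r.party := rfl
    rw [e0, e1, refinedTest_even, refinedTest_odd, h1, h2, h3, h4, zero_smul, add_zero, one_smul]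
    have hE' := (hE.mono (evenOps_subset_fermionicKraus owner r.party)).zPow_comm π (needed u)
    have hO' := (hO.mono (oddOps_subset_fermionicKraus owner r.party)).zPow_comm π (needed u)
    -- In the odd branch the newly needed string `before r.party` cancels the one stripped from the
    -- test. The older corrections commute to the right in both branches, and the even and odd parts
    -- recombine to the original transformation.
    rw [jwSuper_comp, LinearMap.comp_assoc, LinearMap.comp_assoc, hE',
      ← LinearMap.comp_assoc _ _ (conjBy (zPow owner (needed u + before r.party))), conjBy_comp,
      zPow_add, mul_assoc, zPow_mul_self, mul_one, hO', ← LinearMap.comp_add, ← LinearMap.add_comp,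
      ← jwSuper_add, ← hsum, LinearMap.comp_assoc]

/-! ### The closing rounds -/

/-- The parity of the number of odd Kraus operators of the parties after `i`, as announced to the
party `i` by the last entry of its record. -/
def receivedParity {n : ℕ} (i : Fin n) (u : View n) : ℕ :=
  -- The last party has no successor; without this guard an ordinary message at the end of its
  -- record could be taken for a parity bit.
  if i.val + 1 < n then
    match u.getLast? with
    | some (.message _ m) => if m = [true] then 1 else 0
    | _ => 0
  else 0

/-- The party `i` applies its correction and tells its predecessor the parity of the number of odd
Kraus operators of all parties from `i` on. -/
def closingRound {n N : ℕ} (owner : Fin N → Fin n) (i : Fin n) : Round n N where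
  party := i
  outcomes := 1
  test u _ := conjBy (zPow owner fun k => if k = i then receivedParity i u else 0)
  bits j := if j.val + 1 = i.val then 1 else 0
  -- The message is computed after the party's own closing outcome has been recorded. `dropLast`
  -- uncovers the received bit; the outcome itself is `0` and does not affect the count.
  msg _ u _ := decide ((receivedParity i u.dropLast + oddCount u) % 2 = 1)

/-- The closing rounds of the parties `m - 1, …, 0`. -/
def closingRounds {n N : ℕ} (owner : Fin N → Fin n) : (m : ℕ) → m ≤ n → Protocol n N
  | 0, _ => []
  | m + 1, h => closingRound owner ⟨m, h⟩ :: closingRounds owner m (Nat.le_of_succ_le h)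

/-- The parties after `i` are `k` and the parties after `k`. Hence `k` can compute the bit for its
predecessor from the bit it received and its own outcomes. -/
theorem needed_pred {n : ℕ} (u : Fin n → View n) {i k : Fin n} (h : i.val + 1 = k.val) :
    needed u i = needed u k + oddCount (u k) := by
  have e : ∀ j, (if i < j then oddCount (u j) else 0) =
      (if k < j then oddCount (u j) else 0) + if j = k then oddCount (u j) else 0 := by
    intro j
    have h1 : i < j ↔ k < j ∨ j = k := by
      simp only [Fin.lt_def, Fin.ext_iff]; omega
    by_cases h2 : k < j
    · simp [h1, h2, h2.ne']
    · simp [h1, h2]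
  simp only [needed]
  rw [Finset.sum_congr rfl fun j _ => e j, Finset.sum_add_distrib, Finset.sum_ite_eq' Finset.univ]
  simp

theorem receivedParity_next_closingRound {n N : ℕ} (owner : Fin N → Fin n) (u : Fin n → View n)
    {i k : Fin n} (h : i.val + 1 = k.val) :
    receivedParity i ((closingRound owner k).next u 0 i) =
      (receivedParity k (u k) + oddCount (u k)) % 2 := by
  have hik : i ≠ k := by rintro rfl; omega
  have hlt : i.val + 1 < n := h ▸ k.isLt
  have e : (closingRound owner k).next u 0 i = u i ++ [Entry.message k
      [decide ((receivedParity k (u k) + oddCount (u k)) % 2 = 1)]] := by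
    have h1 : oddCount (u k ++ [Entry.outcome 0]) = oddCount (u k) := by
      simp [oddCount_append_outcome]
    simp [Round.next, closingRound, hik, Round.message, h, h1]
  rw [e, receivedParity, if_pos hlt]
  simp only [List.getLast?_append, List.getLast?_singleton, Option.some_or]
  rcases Nat.mod_two_eq_zero_or_one (receivedParity k (u k) + oddCount (u k)) with h2 | h2 <;>
    simp [h2]

-- The hypothesis `hu` concerns only the next party to act: each closing round establishes it for
-- the predecessor. Truncation to length `L` hides the entries of the closing rounds from the event.
open Classical in
theorem event_closingRounds {n N : ℕ} (owner : Fin N → Fin n) (f : View n → View n) (L : ℕ)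
    (S : Set (Fin n → View n)) (m : ℕ) (hm : m ≤ n) (u : Fin n → View n)
    (hL : ∀ i, L ≤ (u i).length)
    (hu : ∀ i : Fin n, i.val + 1 = m → receivedParity i (u i) % 2 = needed u i % 2) :
    event (closingRounds owner m hm) u {w | (fun i => f ((w i).take L)) ∈ S} =
      if (fun i => f ((u i).take L)) ∈ S then
        conjBy (zPow owner fun i => if i.val < m then needed u i else 0) else 0 := by
  induction m generalizing u with
  | zero =>
    have e : conjBy (zPow owner fun _ => 0) = LinearMap.id := by
      rw [← conjBy_one, ← zPow_zero owner]; rfl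
    simp [closingRounds, event, e]
  | succ m ih =>
    have hn : needed ((closingRound owner ⟨m, hm⟩).next u 0) = needed u := by
      rw [needed_next]; simp
    have ht : ∀ i, ((closingRound owner ⟨m, hm⟩).next u 0 i).take L = (u i).take L := by
      intro i
      unfold Round.next
      split_ifs <;> rw [List.take_append_of_le_length (hL i)]
    have e1 : (closingRound owner ⟨m, hm⟩ : Round n N).outcomes = 1 := rfl
    rw [closingRounds, event, e1, Finset.sum_range_one, ih]
    · simp only [ht, hn]
      split_ifs
      · have e2 : (closingRound owner ⟨m, hm⟩).test (u (closingRound owner ⟨m, hm⟩).party) 0 =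
          conjBy (zPow owner fun k => if k = ⟨m, hm⟩ then
            receivedParity ⟨m, hm⟩ (u ⟨m, hm⟩) else 0) := rfl
        rw [e2, conjBy_comp, ← zPow_add]
        congr 1
        refine zPow_congr owner fun i => ?_
        rw [Pi.add_apply]
        -- A party below `m` is corrected in the remaining closing rounds, party `m` in this one,
        -- and parties above `m` need nothing further.
        rcases lt_trichotomy i.val m with h | h | h
        · have h1 : i ≠ ⟨m, hm⟩ := by rintro rfl; exact lt_irrefl _ h
          simp [h, h1, Nat.lt_succ_of_lt h]
        · obtain rfl : i = ⟨m, hm⟩ := Fin.ext h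
          simpa using hu _ rfl
        · have h1 : i ≠ ⟨m, hm⟩ := by rintro rfl; exact lt_irrefl _ h
          simp [h.not_gt, h1, show ¬ i.val < m + 1 by omega]
      · rw [LinearMap.zero_comp]
    · intro i
      rw [length_next]
      exact Nat.le_succ_of_le (hL i)
    · intro i hi
      rw [receivedParity_next_closingRound owner u (k := ⟨m, hm⟩) hi, hn,
        needed_pred u (k := ⟨m, hm⟩) hi, Nat.mod_mod, Nat.add_mod, hu _ rfl, ← Nat.add_mod]

theorem linkBits_closingRounds {n N : ℕ} (owner : Fin N → Fin n) (m : ℕ) (hm : m ≤ n)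
    (i j : Fin n) : linkBits (closingRounds owner m hm) i j =
      if j.val + 1 = i.val ∧ i.val < m then 1 else 0 := by
  induction m with
  | zero => simp [closingRounds, linkBits]
  | succ m ih =>
    rw [closingRounds, linkBits_cons, ih]
    simp only [closingRound]
    by_cases h : (⟨m, hm⟩ : Fin n) = i
    · subst h
      simp only [true_and, lt_irrefl, and_false, if_false, add_zero, Nat.lt_succ_self, and_true]
      by_cases h2 : j.val + 1 = m
      · have : j ≠ ⟨m, hm⟩ := by rintro rfl; simp at h2
        simp [h2, this]
      · simp [h2]
    · have h2 : i.val ≠ m := fun h' => h (Fin.ext h'.symm)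
      have h3 : i.val < m + 1 ↔ i.val < m := by omega
      simp [h, h3]

theorem linkBits_refinedRounds {n N : ℕ} (owner : Fin N → Fin n) (π : Equiv.Perm (Fin N))
    (P : Protocol n N) (i j : Fin n) :
    linkBits (P.map (refinedRound owner π)) i j = linkBits P i j := by
  induction P with
  | nil => rfl
  | cons r P ih => rw [List.map_cons, linkBits_cons, linkBits_cons, ih]; rfl

theorem isTest_zPow_single {n N : ℕ} (owner : Fin N → Fin n) (i : Fin n) (m : ℕ)
    {T : ℕ → SuperOp N} (hT : T 0 = conjBy (zPow owner fun k => if k = i then m else 0)) :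
    IsTest (qubitKraus owner i) 1 T :=
  isTest_one (zPow_single_mem owner i m) (by rw [conjTranspose_zPow, zPow_mul_self]) hT

theorem isQubitLOCC_closingRounds {n N : ℕ} (owner : Fin N → Fin n) (m : ℕ) (hm : m ≤ n) :
    IsQubitLOCC owner (closingRounds owner m hm) := by
  induction m with
  | zero => intro r hr; simp [closingRounds] at hr
  | succ m ih =>
    intro r hr v
    rcases List.mem_cons.1 hr with rfl | hr
    · exact isTest_zPow_single owner ⟨m, hm⟩ _ rfl
    · exact ih _ r hr v

theorem isQubitLOCC_refinedRounds {n N : ℕ} {owner : Fin N → Fin n} {π : Equiv.Perm (Fin N)}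
    (hπ : Monotone (owner ∘ π)) {P : Protocol n N} (hP : IsFermionicLOCC owner P) :
    IsQubitLOCC owner (P.map (refinedRound owner π)) := by
  intro q hq v
  obtain ⟨r, hr, rfl⟩ := List.mem_map.1 hq
  exact isTest_refinedTest hπ (hP r hr _)

theorem corresponds_refinedRounds_append_closingRounds {n N : ℕ} (owner : Fin N → Fin n)
    (π : Equiv.Perm (Fin N)) {P : Protocol n N} (hP : IsFermionicLOCC owner P) :
    Corresponds π (fun _ u => (u.take P.length).map Entry.halve) P
      (P.map (refinedRound owner π) ++ closingRounds owner n le_rfl) := by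
  classical
  intro S ρ
  rw [← jwSuper_jordanWigner, event_append]
  congr 1
  have h := run_refinedRounds owner π P hP S fun _ => []
  have e : conjBy (zPow owner (needed fun _ : Fin n => ([] : View n))) = LinearMap.id := by
    rw [← conjBy_one, ← zPow_zero owner]
    congr 2
    ext i
    simp [needed, oddCount]
  rw [e, LinearMap.comp_id] at h
  -- The event of the closing rounds reads only the first `P.length` entries, which are the whole
  -- record when the refined rounds end.
  refine h.symm.trans (run_congr _ (m := 0) (by simp) fun w hw => ?_)
  rw [List.length_map, zero_add] at hw
  rw [event_closingRounds owner (List.map Entry.halve) P.length S n le_rfl w fun i => (hw i).ge]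
  · simp only [Fin.is_lt, if_true]
    have ht : ∀ i, (w i).take P.length = w i := fun i => by rw [← hw i, List.take_length]
    simp only [ht]
  -- The downward chain starts at the last party, which received no bit and has no party after it.
  · intro i hi
    rw [receivedParity, if_neg (by omega), needed, Finset.sum_eq_zero]
    intro j _
    rw [if_neg]
    rw [Fin.lt_def]
    omega

theorem exists_perm_monotone_comp {n N : ℕ} (owner : Fin N → Fin n) :
    ∃ π : Equiv.Perm (Fin N), Monotone (owner ∘ π) :=
  ⟨Tuple.sort owner, Tuple.monotone_sort owner⟩

theorem exists_qubitLOCC_corresponds {n N : ℕ} (owner : Fin N → Fin n) (π : Equiv.Perm (Fin N))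
    (hπ : Monotone (owner ∘ π)) (P : Protocol n N) (hP : IsFermionicLOCC owner P) :
    ∃ (Q : Protocol n N) (f : Fin n → View n → View n),
      IsQubitLOCC owner Q ∧ Corresponds π f P Q ∧
      (∀ i j : Fin n, linkBits Q i j = linkBits P i j + if j.val + 1 = i.val then 1 else 0) ∧
      totalBits Q = totalBits P + (n - 1) := by
  have hlink : ∀ i j : Fin n,
      linkBits (P.map (refinedRound owner π) ++ closingRounds owner n le_rfl) i j =
        linkBits P i j + if j.val + 1 = i.val then 1 else 0 := by
    intro i j
    rw [linkBits_append, linkBits_refinedRounds, linkBits_closingRounds]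
    simp
  refine ⟨_, _, ?_, corresponds_refinedRounds_append_closingRounds owner π hP, hlink, ?_⟩
  · intro r hr
    rcases List.mem_append.1 hr with hr | hr
    · exact isQubitLOCC_refinedRounds hπ hP r hr
    · exact isQubitLOCC_closingRounds owner n le_rfl r hr
  · simp only [totalBits, hlink, Finset.sum_add_distrib, sum_sum_pred]

/-! ### Simulation of two parties round by round -/

/-- Reads a record entry by entry by means of `d`. The entry after an entry with the property `p` is
skipped, and so is the first entry if `skip` holds. -/
def parse {n : ℕ} (d : Entry n → Entry n) (p : Entry n → Bool) : Bool → View n → View n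
  | _, [] => []
  | true, _ :: u => parse d p false u
  | false, e :: u => d e :: parse d p (p e) u

/-- `parse` skips the next entry after the record. -/
def pending {n : ℕ} (p : Entry n → Bool) : Bool → View n → Bool
  | skip, [] => skip
  | true, _ :: u => pending p false u
  | false, e :: u => pending p (p e) u

theorem parse_append {n : ℕ} (d : Entry n → Entry n) (p : Entry n → Bool) (skip : Bool)
    (u w : View n) : parse d p skip (u ++ w) = parse d p skip u ++ parse d p (pending p skip u) w := by
  induction u generalizing skip with
  | nil => cases skip <;> simp [parse, pending]
  | cons e u ih => cases skip <;> simp [parse, pending, ih]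

theorem pending_append {n : ℕ} (p : Entry n → Bool) (skip : Bool) (u w : View n) :
    pending p skip (u ++ w) = pending p (pending p skip u) w := by
  induction u generalizing skip with
  | nil => cases skip <;> simp [pending]
  | cons e u ih => cases skip <;> simp [pending, ih]

/-- The entries of the party `i` that belong to the first of the two rounds that simulate a round of
the party `1`. -/
def isSecondPartyEntry (i : Fin 2) : Entry 2 → Bool
  | .outcome _ => i == 1
  | .message _ _ => i == 0

/-- The entry of the simulated protocol: the party `0` forgets the additional bit, the party `1` the
parity of the outcome. -/
def readEntry (i : Fin 2) : Entry 2 → Entry 2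
  | .outcome b => .outcome (if i = 1 then b / 2 else b)
  | .message j m => .message j (if i = 0 then m.dropLast else m)

/-- The record of the simulated protocol. -/
def readView (i : Fin 2) (u : View 2) : View 2 :=
  parse (readEntry i) (isSecondPartyEntry i) false u

/-- All rounds in the record have been simulated completely. -/
def IsComplete (i : Fin 2) (u : View 2) : Prop := pending (isSecondPartyEntry i) false u = false

theorem readView_append_one {i : Fin 2} {u : View 2} (hu : IsComplete i u) (e : Entry 2) :
    readView i (u ++ [e]) = readView i u ++ [readEntry i e] := by
  unfold IsComplete at hu
  rw [readView, parse_append, hu]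
  rfl

theorem isComplete_append_one {i : Fin 2} {u : View 2} (hu : IsComplete i u) {e : Entry 2}
    (he : isSecondPartyEntry i e = false) : IsComplete i (u ++ [e]) := by
  unfold IsComplete at *
  rw [pending_append, hu]
  exact he

/-- A correction adds one entry on each side, an outcome for party `0` and an empty message for
party `1`. It directly follows the entry of the round being corrected, so it can be recognized from
a party's own record and skipped. -/
theorem readView_append_two {i : Fin 2} {u : View 2} (hu : IsComplete i u) {e : Entry 2}
    (he : isSecondPartyEntry i e = true) (e' : Entry 2) :
    readView i (u ++ [e] ++ [e']) = readView i u ++ [readEntry i e] := by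
  unfold IsComplete at hu
  rw [readView, List.append_assoc, parse_append, hu]
  simp [parse, he, readView]

theorem isComplete_append_two {i : Fin 2} {u : View 2} (hu : IsComplete i u) {e : Entry 2}
    (he : isSecondPartyEntry i e = true) (e' : Entry 2) : IsComplete i (u ++ [e] ++ [e']) := by
  unfold IsComplete at *
  rw [List.append_assoc, pending_append, hu]
  simp [pending, he]

/-- The simulation of a round of the party `0`. -/
def firstPartyRound {N : ℕ} (π : Equiv.Perm (Fin N)) (r : Round 2 N) : Round 2 N where
  party := 0
  outcomes := r.outcomes
  test u a := jwSuper π (r.test (readView 0 u) a)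
  bits := r.bits
  -- The last entry is the party's own new outcome and is kept unread: the message condition is
  -- required for all records, including those in which `readView` would skip the next entry.
  msg j w := r.msg j (readView 0 w.dropLast ++ w.getLast?.toList)

/-- The simulation of a round of the party `1`, up to the correction. -/
def secondPartyRound {N : ℕ} (owner : Fin N → Fin 2) (π : Equiv.Perm (Fin N)) (r : Round 2 N) :
    Round 2 N where
  party := 1
  outcomes := 2 * r.outcomes
  test u := refinedTest owner π 1 (r.test (readView 1 u))
  bits j := r.bits j + 1
  msg j w k :=
    if k < r.bits j then
      r.msg j (readView 1 w.dropLast ++ w.getLast?.toList.map Entry.halve) k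
    else w.getLast?.toList.any Entry.isOdd

/-- The additional bit at the end of a record that ends with a message. -/
def correctionBit (u : View 2) : ℕ :=
  match u.getLast? with
  | some (.message _ m) => if m.getLast? = some true then 1 else 0
  | _ => 0

/-- The correction of the party `0` after the simulation of a round of the party `1`. -/
def correctionRound {N : ℕ} (owner : Fin N → Fin 2) : Round 2 N where
  party := 0
  outcomes := 1
  test u _ := conjBy (zPow owner fun k => if k = 0 then correctionBit u else 0)
  bits _ := 0
  msg _ _ _ := false

/-- The simulation of a round. -/
def roundBlock {N : ℕ} (owner : Fin N → Fin 2) (π : Equiv.Perm (Fin N)) (r : Round 2 N) :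
    Protocol 2 N :=
  if r.party = 0 then [firstPartyRound π r]
  else [secondPartyRound owner π r, correctionRound owner]

theorem before_one : before (1 : Fin 2) = fun k => if k = 0 then 1 else 0 := by
  ext k
  fin_cases k <;> simp [before]

theorem zString_zero_eq {N : ℕ} (owner : Fin N → Fin 2) :
    zString owner 0 = zPow owner (before 1) := by
  rw [before_one, zString_eq_zPow]

theorem firstPartyRound_message {N : ℕ} (π : Equiv.Perm (Fin N)) (r : Round 2 N) (j : Fin 2)
    (u : View 2) (a : ℕ) :
    (firstPartyRound π r).message j (u ++ [Entry.outcome a]) =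
      r.message j (readView 0 u ++ [Entry.outcome a]) := by
  simp [Round.message, firstPartyRound]

theorem secondPartyRound_message {N : ℕ} (owner : Fin N → Fin 2) (π : Equiv.Perm (Fin N))
    (r : Round 2 N) (j : Fin 2) (u : View 2) (b : ℕ) :
    (secondPartyRound owner π r).message j (u ++ [Entry.outcome b]) =
      r.message j (readView 1 u ++ [Entry.outcome (b / 2)]) ++ [b % 2 == 1] := by
  simp only [Round.message, secondPartyRound, List.range_succ, List.map_append, List.map_cons,
    List.map_nil, lt_irrefl, if_false, List.dropLast_concat, List.getLast?_append,
    List.getLast?_singleton, Option.some_or, Option.toList_some, Entry.halve, List.any_cons,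
    List.any_nil, Bool.or_false, Entry.isOdd]
  congr 1
  refine List.map_congr_left fun k hk => ?_
  rw [if_pos (List.mem_range.1 hk)]

theorem correctionBit_append (u : View 2) (j : Fin 2) (m : List Bool) (b : Bool) :
    correctionBit (u ++ [Entry.message j (m ++ [b])]) = if b then 1 else 0 := by
  simp [correctionBit]

theorem conjBy_zPow_ite_zero {N : ℕ} (owner : Fin N → Fin 2) :
    conjBy (zPow owner fun k => if k = 0 then 0 else 0) = LinearMap.id := by
  rw [← conjBy_one, ← zPow_zero owner]
  congr 2
  ext k
  simp

theorem conjBy_zPow_involutive {n N : ℕ} (owner : Fin N → Fin n) (x : Fin n → ℕ) :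
    conjBy (zPow owner x) ∘ₗ conjBy (zPow owner x) = LinearMap.id := by
  rw [conjBy_comp, zPow_mul_self, conjBy_one]

theorem isFirstPartyRound_firstPartyRound {N : ℕ} (π : Equiv.Perm (Fin N)) (r : Round 2 N) :
    IsFirstPartyRound π readView r (firstPartyRound π r) where
  party_eq := rfl
  outcomes_eq := rfl
  test_eq _ _ _ _ := (jwSuper_jordanWigner _ _ _).symm
  bits_eq := rfl
  message_eq _ _ _ := firstPartyRound_message _ _ _ _ _

theorem isSecondPartyRound_secondPartyRound {N : ℕ} (owner : Fin N → Fin 2)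
    (π : Equiv.Perm (Fin N)) (r : Round 2 N)
    (hr : ∀ v, IsTest (fermionicKraus owner 1) r.outcomes (r.test v)) :
    IsSecondPartyRound owner π readView r (secondPartyRound owner π r)
      (correctionRound owner) where
  party_eq := rfl
  outcomes_eq := rfl
  test_eq u a ha := by
    obtain ⟨hE, hO, h⟩ := evenPart_oddPart_spec ((hr (readView 1 u)).1 a ha)
    refine ⟨_, _, hE, hO, h, fun ρ => ?_, fun ρ => ?_⟩
    · simp only [secondPartyRound]
      rw [refinedTest_even, jwSuper_jordanWigner]
    · simp only [secondPartyRound]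
      -- Party `0` is the only party before party `1`, so the stripped string is exactly its
      -- `σ_z`-string, and the correction cancels it.
      rw [refinedTest_odd, zString_zero_eq, ← LinearMap.comp_apply, ← LinearMap.comp_assoc,
        conjBy_zPow_involutive, LinearMap.id_comp, jwSuper_jordanWigner]
  bits_eq := rfl
  message_even u a _ := by
    rw [secondPartyRound_message]
    simp
  message_odd u a _ := by
    have h1 : (2 * a + 1) / 2 = a := by omega
    have h2 : (2 * a + 1) % 2 = 1 := by omega
    rw [secondPartyRound_message, h1, h2]
    rfl
  correction_party := rfl
  correction_outcomes := rfl
  correction_even u m := by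
    simp only [correctionRound, correctionBit_append]
    exact conjBy_zPow_ite_zero owner
  correction_odd u m := by
    simp only [correctionRound, correctionBit_append, zString_eq_zPow, if_true]
  correction_bits := rfl

theorem eq_one_of_ne_zero {i : Fin 2} (h : i ≠ 0) : i = 1 := by omega

theorem isRoundBlock_roundBlock {N : ℕ} (owner : Fin N → Fin 2) (π : Equiv.Perm (Fin N))
    (r : Round 2 N) (hr : ∀ v, IsTest (fermionicKraus owner r.party) r.outcomes (r.test v)) :
    IsRoundBlock owner π readView r (roundBlock owner π r) := by
  unfold roundBlock
  by_cases h : r.party = 0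
  · rw [if_pos h]
    exact Or.inl ⟨h, _, rfl, isFirstPartyRound_firstPartyRound π r⟩
  · have h1 := eq_one_of_ne_zero h
    rw [if_neg h]
    rw [h1] at hr
    exact Or.inr ⟨h1, _, _, rfl, isSecondPartyRound_secondPartyRound owner π r hr⟩

theorem isQubitLOCC_roundBlock {N : ℕ} {owner : Fin N → Fin 2} {π : Equiv.Perm (Fin N)}
    (hπ : Monotone (owner ∘ π)) (r : Round 2 N)
    (hr : ∀ v, IsTest (fermionicKraus owner r.party) r.outcomes (r.test v)) :
    IsQubitLOCC owner (roundBlock owner π r) := by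
  unfold roundBlock
  by_cases h : r.party = 0
  · rw [if_pos h]
    rw [h] at hr
    intro q hq v
    obtain rfl := List.mem_singleton.1 hq
    exact isTest_jwSuper hπ (fun j => Fin.not_lt_zero j) (hr _)
  · rw [if_neg h]
    rw [eq_one_of_ne_zero h] at hr
    intro q hq v
    rcases List.mem_cons.1 hq with rfl | hq
    · exact isTest_refinedTest hπ (hr _)
    · obtain rfl := List.mem_singleton.1 hq
      exact isTest_zPow_single owner 0 _ rfl

theorem totalBits_roundBlock {N : ℕ} (owner : Fin N → Fin 2) (π : Equiv.Perm (Fin N))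
    (r : Round 2 N) :
    totalBits (roundBlock owner π r) = totalBits [r] + if r.party = 1 then 1 else 0 := by
  by_cases h : r.party = 0
  · simp [roundBlock, totalBits, linkBits, Fin.sum_univ_two, h, firstPartyRound]
  · have h1 := eq_one_of_ne_zero h
    simp [roundBlock, totalBits, linkBits, Fin.sum_univ_two, h1, secondPartyRound, correctionRound]

theorem totalBits_flatten_map_roundBlock {N : ℕ} (owner : Fin N → Fin 2)
    (π : Equiv.Perm (Fin N)) (P : Protocol 2 N) :
    totalBits (P.map (roundBlock owner π)).flatten =
      totalBits P + P.countP (fun r => r.party = 1) := by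
  induction P with
  | nil => simp
  | cons r P ih =>
    rw [List.map_cons, List.flatten_cons, totalBits_append, ih, totalBits_roundBlock,
      List.countP_cons, show totalBits (r :: P) = totalBits [r] + totalBits P from
        totalBits_append [r] P]
    simp only [decide_eq_true_eq]
    omega

theorem readView_firstPartyRound_next {N : ℕ} (π : Equiv.Perm (Fin N)) {r : Round 2 N}
    (hr : r.party = 0) {u : Fin 2 → View 2} (hu : ∀ i, IsComplete i (u i)) (a : ℕ) :
    (fun i => readView i ((firstPartyRound π r).next u a i)) =
        r.next (fun i => readView i (u i)) a ∧
      ∀ i, IsComplete i ((firstPartyRound π r).next u a i) := by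
  have e1 : (firstPartyRound π r).party = 0 := rfl
  have h0 : (firstPartyRound π r).next u a 0 = u 0 ++ [Entry.outcome a] := by
    simp [Round.next, e1]
  have h1 : (firstPartyRound π r).next u a 1 = u 1 ++
      [Entry.message 0 (r.message 1 (readView 0 (u 0) ++ [Entry.outcome a]))] := by
    simp [Round.next, e1, firstPartyRound_message]
  constructor
  · ext1 i
    match i with
    | 0 => rw [h0, readView_append_one (hu 0)]; simp [Round.next, hr, readEntry]
    | 1 => rw [h1, readView_append_one (hu 1)]; simp [Round.next, hr, readEntry]
  · intro i
    match i with
    | 0 => rw [h0]; exact isComplete_append_one (hu 0) rfl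
    | 1 => rw [h1]; exact isComplete_append_one (hu 1) rfl

theorem readView_correctionRound_next {N : ℕ} (owner : Fin N → Fin 2) (π : Equiv.Perm (Fin N))
    {r : Round 2 N} (hr : r.party = 1) {u : Fin 2 → View 2} (hu : ∀ i, IsComplete i (u i))
    (b : ℕ) :
    (fun i => readView i
        ((correctionRound owner).next ((secondPartyRound owner π r).next u b) 0 i)) =
        r.next (fun i => readView i (u i)) (b / 2) ∧
      ∀ i, IsComplete i
        ((correctionRound owner).next ((secondPartyRound owner π r).next u b) 0 i) := by
  have e1 : (secondPartyRound owner π r).party = 1 := rfl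
  have e2 : (correctionRound owner).party = 0 := rfl
  have h0 : (correctionRound owner).next ((secondPartyRound owner π r).next u b) 0 0 = u 0 ++
      [Entry.message 1 (r.message 0 (readView 1 (u 1) ++ [Entry.outcome (b / 2)]) ++
        [b % 2 == 1])] ++ [Entry.outcome 0] := by
    simp [Round.next, e1, e2, secondPartyRound_message]
  have h1 : (correctionRound owner).next ((secondPartyRound owner π r).next u b) 0 1 = u 1 ++
      [Entry.outcome b] ++ [Entry.message 0 []] := by
    simp [Round.next, e1, e2, Round.message, show (correctionRound owner).bits 1 = 0 from rfl]
  constructor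
  · ext1 i
    match i with
    | 0 => rw [h0, readView_append_two (hu 0) rfl]; simp [Round.next, hr, readEntry]
    | 1 => rw [h1, readView_append_two (hu 1) rfl]; simp [Round.next, hr, readEntry]
  · intro i
    match i with
    | 0 => rw [h0]; exact isComplete_append_two (hu 0) rfl _
    | 1 => rw [h1]; exact isComplete_append_two (hu 1) rfl _

theorem correctionRound_test {N : ℕ} (owner : Fin N → Fin 2) (π : Equiv.Perm (Fin N))
    (r : Round 2 N) (u : Fin 2 → View 2) (b : ℕ) :
    (correctionRound owner).test ((secondPartyRound owner π r).next u b 0) 0 =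
      if b % 2 = 1 then conjBy (zPow owner (before 1)) else LinearMap.id := by
  have h : (secondPartyRound owner π r).next u b 0 = u 0 ++
      [Entry.message 1 (r.message 0 (readView 1 (u 1) ++ [Entry.outcome (b / 2)]) ++
        [b % 2 == 1])] := by
    simp [Round.next, show (secondPartyRound owner π r).party = 1 from rfl,
      secondPartyRound_message]
  simp only [correctionRound, h, correctionBit_append]
  rcases Nat.mod_two_eq_zero_or_one b with hb | hb
  · simp only [hb]
    exact conjBy_zPow_ite_zero owner
  · simp [hb, before_one]

/-- Completeness of the records is preserved by each block and guarantees that the next entry is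
read. As every block ends with its correction carried out, no string is left over, in contrast to
`run_refinedRounds`. -/
theorem event_flatten_map_roundBlock {N : ℕ} (owner : Fin N → Fin 2) (π : Equiv.Perm (Fin N))
    (P : Protocol 2 N) (hP : IsFermionicLOCC owner P) (S : Set (Fin 2 → View 2))
    (u : Fin 2 → View 2) (hu : ∀ i, IsComplete i (u i)) :
    event (P.map (roundBlock owner π)).flatten u {w | (fun i => readView i (w i)) ∈ S} =
      jwSuper π (event P (fun i => readView i (u i)) S) := by
  classical
  induction P generalizing u with
  | nil =>
    simp only [List.map_nil, List.flatten_nil, event, Set.mem_ofPred_eq]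
    split_ifs
    · rw [jwSuper_id]
    · rw [jwSuper_zero]
  | cons r P ih =>
    have ih := ih fun r' hr' => hP r' (List.mem_cons_of_mem _ hr')
    have hr := hP r List.mem_cons_self
    rw [List.map_cons, List.flatten_cons, roundBlock]
    by_cases h : r.party = 0
    · rw [if_pos h, List.singleton_append, event, event, jwSuper_sum]
      refine Finset.sum_congr rfl fun a _ => ?_
      obtain ⟨h1, h2⟩ := readView_firstPartyRound_next π h hu a
      rw [ih _ h2, h1, jwSuper_comp, h]
      rfl
    · have h' := eq_one_of_ne_zero h
      rw [if_neg h, List.cons_append, List.singleton_append, event, event, jwSuper_sum]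
      refine (sum_range_two_mul _ _).trans (Finset.sum_congr rfl fun a ha => ?_)
      rw [h'] at hr
      obtain ⟨-, -, hsum⟩ :=
        evenPart_oddPart_spec ((hr (readView 1 (u 1))).1 a (Finset.mem_range.1 ha))
      -- The correction has a single outcome, so it contributes one factor, determined by the parity
      -- of `b`, before the simulation of the remaining rounds.
      have key : ∀ b, event (correctionRound owner :: (P.map (roundBlock owner π)).flatten)
          ((secondPartyRound owner π r).next u b) {w | (fun i => readView i (w i)) ∈ S} =
          jwSuper π (event P (r.next (fun i => readView i (u i)) (b / 2)) S) ∘ₗ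
            if b % 2 = 1 then conjBy (zPow owner (before 1)) else LinearMap.id := by
        intro b
        obtain ⟨h1, h2⟩ := readView_correctionRound_next owner π h' hu b
        rw [event, show (correctionRound owner).outcomes = 1 from rfl, Finset.sum_range_one,
          ih _ h2, h1, show (correctionRound owner).party = 0 from rfl, correctionRound_test]
      have e0 : (secondPartyRound owner π r).test (u (secondPartyRound owner π r).party) =
        refinedTest owner π 1 (r.test (readView 1 (u 1))) := rfl
      have h1 : (2 * a) / 2 = a := by omega
      have h2 : (2 * a + 1) / 2 = a := by omega
      have h3 : ¬ (2 * a) % 2 = 1 := by omega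
      have h4 : (2 * a + 1) % 2 = 1 := by omega
      rw [key, key, e0, refinedTest_even, refinedTest_odd, h1, h2, if_neg h3, if_pos h4,
        LinearMap.comp_id, LinearMap.comp_assoc, ← LinearMap.comp_assoc _ _ (conjBy _),
        conjBy_zPow_involutive, LinearMap.id_comp, ← LinearMap.comp_add, ← jwSuper_add, ← hsum,
        jwSuper_comp, h']

theorem exists_roundBlocks {N : ℕ} (owner : Fin N → Fin 2) (π : Equiv.Perm (Fin N))
    (hπ : Monotone (owner ∘ π)) (P : Protocol 2 N) (hP : IsFermionicLOCC owner P) :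
    ∃ (B : List (Protocol 2 N)) (f : Fin 2 → View 2 → View 2),
      IsQubitLOCC owner B.flatten ∧
      List.Forall₂ (IsRoundBlock owner π f) P B ∧
      (∀ m : ℕ, Corresponds π f (P.take m) (B.take m).flatten) ∧
      totalBits B.flatten = totalBits P + P.countP (fun r => r.party = 1) := by
  refine ⟨P.map (roundBlock owner π), readView, ?_, ?_, fun m S ρ => ?_,
    totalBits_flatten_map_roundBlock owner π P⟩
  · intro q hq
    obtain ⟨b, hb, hq⟩ := List.mem_flatten.1 hq
    obtain ⟨r, hr, rfl⟩ := List.mem_map.1 hb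
    exact isQubitLOCC_roundBlock hπ r (hP r hr) q hq
  · rw [List.forall₂_map_right_iff, List.forall₂_same]
    exact fun r hr => isRoundBlock_roundBlock owner π r (hP r hr)
  -- Blocks correspond to rounds one by one, so an initial segment of blocks is the simulation of
  -- the initial segment of `P`.
  · rw [← List.map_take, event_flatten_map_roundBlock owner π (P.take m)
      (fun r hr => hP r (List.mem_of_mem_take hr)) S (fun _ => []) fun _ => rfl,
      jwSuper_jordanWigner]
    rfl

end

end FermionicLOCC

theorem propositionp (N : ℕ) :
    -- `n` parties: `n - 1` bits of overhead, one from each party to its predecessor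
    (∀ (n : ℕ) (owner : Fin N → Fin n),
      (∃ π : Equiv.Perm (Fin N), Monotone (owner ∘ π)) ∧
      ∀ π : Equiv.Perm (Fin N), Monotone (owner ∘ π) →
        ∀ P : Protocol n N, IsFermionicLOCC owner P →
          ∃ (Q : Protocol n N) (f : Fin n → View n → View n),
            IsQubitLOCC owner Q ∧ Corresponds π f P Q ∧
            (∀ i j : Fin n,
              linkBits Q i j = linkBits P i j + if j.val + 1 = i.val then 1 else 0) ∧
            totalBits Q = totalBits P + (n - 1)) ∧
    -- two parties: round by round, one bit of overhead for each round of the party `1`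
    (∀ (owner : Fin N → Fin 2) (π : Equiv.Perm (Fin N)), Monotone (owner ∘ π) →
      ∀ P : Protocol 2 N, IsFermionicLOCC owner P →
        ∃ (B : List (Protocol 2 N)) (f : Fin 2 → View 2 → View 2),
          IsQubitLOCC owner B.flatten ∧
          List.Forall₂ (IsRoundBlock owner π f) P B ∧
          (∀ m : ℕ, Corresponds π f (P.take m) (B.take m).flatten) ∧
          totalBits B.flatten = totalBits P + P.countP (fun r => r.party = 1)) := by
  exact ⟨fun n owner => ⟨exists_perm_monotone_comp owner, exists_qubitLOCC_corresponds owner⟩,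
    exists_roundBlocks⟩
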